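/- Let $p$ be a prime number, $F=\mathbb{Q}(\sqrt{p})$ with ring of integers $O_F$, and let $D=D_{\infty_1,\infty_2}$ be the quaternion $F$-algebra ramified exactly at the two infinite places of $F$. Write $\widehat{F}$ for the ring of finite adeles of $F$, $\widehat{D}=D\otimes_F\widehat{F}$, $\widehat{D}^1$ for the group of elements of $\widehat{D}^\times$ of reduced norm $1$, and $\widehat{\Lambda}\subset\widehat{D}$ for the profinite completion of an $O_F$-lattice $\Lambda\subset D$ (a finitely generated $O_F$-submodule that spans $D$ over $F$). Let $\mathbb{O}$ be a maximal $O_F$-order in $D$. A locally principal right $\mathbb{O}$-ideal is an $O_F$-lattice $I\subset D$ with $I\mathbb{O}\subseteq I$ and $\widehat{I}=x\widehat{\mathbb{O}}$ for some $x\in\widehat{D}^\times$; its class is $[I]=\{\alpha I\mid\alpha\in D^\times\}$, and its left order is $\mathcal{O}_l(I)=\{\alpha\in D\mid\alpha I\subseteq I\}$. It lies in the spinor class of $\mathbb{O}$ if $\widehat{I}=x\widehat{\mathbb{O}}$ for some $x\in D^\times\widehat{D}^1$. Let $\mathrm{Cl}_{\mathrm{sc}}(\mathbb{O})$ be the set of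 classes $[I]$ of locally principal right $\mathbb{O}$-ideals $I$ in the spinor class of $\mathbb{O}$, and let $h_{\mathrm{sc}}(\mathbb{O})$ be its cardinality. The type of an $O_F$-order $\mathcal{O}\subset D$ is $[\![\mathcal{O}]\!]=\{\alpha\mathcal{O}\alpha^{-1}\mid\alpha\in D^\times\}$. An $O_F$-order $\mathcal{O}\subset D$ lies in the spinor genus of $\mathbb{O}$ if $\widehat{\mathcal{O}}=x\widehat{\mathbb{O}}x^{-1}$ for some $x\in D^\times\widehat{D}^1$. Let $\mathrm{Tp}_{\mathrm{sg}}(\mathbb{O})$ be the set of types $[\![\mathcal{O}]\!]$ of the $O_F$-orders $\mathcal{O}$ in the spinor genus of $\mathbb{O}$. Then the map $$\Upsilon:\mathrm{Cl}_{\mathrm{sc}}(\mathbb{O})\to\mathrm{Tp}_{\mathrm{sg}}(\mathbb{O}),\qquad [I]\mapsto[\![\mathcal{O}_l(I)]\!]$$ is well defined and bijective. Consequently $h_{\mathrm{sc}}(\mathbb{O})=|\mathrm{Tp}_{\mathrm{sg}}(\mathbb{O})|$, the spinor type number of $\mathbb{O}$. -/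

import Mathlib

open scoped Quaternion NumberField

noncomputable section

namespace SpinorType

/-! Quaternion algebras `(a, b / F) = ℍ[F, a, b]`: basis `1, i, j, ij`, with `i² = a`, `j² = b`,
`ji = -ij`. For an `F`-algebra `R`, the base change `(a, b / F) ⊗ R` is `ℍ[R, a, b]`. -/

/-- The quaternion algebra `(a, b / F)`. -/
abbrev Quat {F : Type*} [Field F] (a b : F) : Type _ := ℍ[F, a, b]

/-- The base change of `(a, b / F)` to a commutative `F`-algebra `R`. -/
abbrev QuatOver {F : Type*} [Field F] (R : Type*) [CommRing R] [Algebra F R] (a b : F) : Type _ :=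
  ℍ[R, algebraMap F R a, algebraMap F R b]

/-- The canonical ring homomorphism from `(a, b / F)` to its base change to `R`. -/
def toQuatOver {F : Type*} [Field F] (R : Type*) [CommRing R] [Algebra F R] (a b : F) :
    Quat a b →+* QuatOver R a b where
  toFun x := ⟨algebraMap F R x.re, algebraMap F R x.imI, algebraMap F R x.imJ,
    algebraMap F R x.imK⟩
  map_one' := by ext <;> simp
  map_mul' x y := by ext <;> simp
  map_zero' := by ext <;> simp
  map_add' x y := by ext <;> simp

/-- The reduced norm `Nr x = x x̄`, where `x̄ = star x` is the canonical involution. -/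
def nr {R : Type*} [CommRing R] {a b : R} (x : ℍ[R, a, b]) : R := (x * star x).re

theorem mul_star_eq_nr {R : Type*} [CommRing R] {a b : R} (x : ℍ[R, a, b]) :
    x * star x = ((nr x : R) : ℍ[R, a, b]) := QuaternionAlgebra.mul_star_eq_coe x

/-- `(a, b / F)` is split over the extension `K` of `F`. -/
def IsSplitOver {F : Type*} [Field F] (K : Type*) [Field K] [Algebra F K] (a b : F) : Prop :=
  Nonempty (QuatOver K a b ≃ₐ[K] Matrix (Fin 2) (Fin 2) K)

/-- `(a, b / F)` is totally definite: for every embedding `σ : F → ℝ`, its scalar extension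
along `σ` is Hamilton's quaternion algebra. -/
def IsTotallyDefinite {F : Type*} [Field F] (a b : F) : Prop :=
  ∀ σ : F →+* ℝ, Nonempty (ℍ[ℝ, σ a, σ b] ≃ₐ[ℝ] ℍ[ℝ])

section

variable {F : Type*} [Field F] [NumberField F]

/-- `(a, b / F)` is a quaternion algebra over a totally real field `F`, ramified exactly at the
infinite places of `F`. -/
structure IsRamifiedExactlyAtInfinity (a b : F) : Prop where
  left_ne_zero : a ≠ 0
  right_ne_zero : b ≠ 0
  totallyDefinite : IsTotallyDefinite a b
  split : ∀ v : IsDedekindDomain.HeightOneSpectrum (𝓞 F), IsSplitOver (v.adicCompletion F) a b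

variable (F) in
/-- The ring of finite adeles of `F`. -/
abbrev FinAdele : Type _ := IsDedekindDomain.FiniteAdeleRing (𝓞 F) F

variable (F) in
/-- The profinite completion of the ring of integers, as a subring of the finite adeles. -/
def integralAdeles : Subring (FinAdele F) where
  carrier := {x | ∀ v : IsDedekindDomain.HeightOneSpectrum (𝓞 F), x v ∈ v.adicCompletionIntegers F}
  one_mem' _ := one_mem _
  mul_mem' hx hy v := mul_mem (hx v) (hy v)
  zero_mem' _ := zero_mem _
  add_mem' hx hy v := add_mem (hx v) (hy v)
  neg_mem' hx v := neg_mem (hx v)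

/-- The ring of finite adeles of the quaternion algebra `(a, b / F)`. -/
abbrev AdelicQuat (a b : F) : Type _ := QuatOver (FinAdele F) a b

variable {a b : F}

/-- The profinite completion of an `𝓞 F`-lattice in `(a, b / F)`, as a submodule of the ring of
finite adeles of `(a, b / F)` over the profinite completion of `𝓞 F`. -/
def hat (I : Submodule (𝓞 F) (Quat a b)) : Submodule (integralAdeles F) (AdelicQuat a b) :=
  Submodule.span (integralAdeles F) (toQuatOver (FinAdele F) a b '' (I : Set (Quat a b)))

/-- An `𝓞 F`-order: a subring that is a (full) `𝓞 F`-lattice. -/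
def IsOrder (O : Subalgebra (𝓞 F) (Quat a b)) : Prop :=
  Submodule.IsLattice F (Subalgebra.toSubmodule O)

/-- An order that is maximal with respect to inclusion. -/
def IsMaximalOrder (O : Subalgebra (𝓞 F) (Quat a b)) : Prop :=
  Maximal IsOrder O

/-- The product set `D^× D̂^1`, where `D̂^1` is the group of elements of reduced norm `1`. -/
def spinorUnits (a b : F) : Set (AdelicQuat a b)ˣ :=
  {x | ∃ (α : (Quat a b)ˣ) (y : (AdelicQuat a b)ˣ), nr (y : AdelicQuat a b) = 1 ∧
    x = Units.map (toQuatOver (FinAdele F) a b : Quat a b →* AdelicQuat a b) α * y}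

/-- `I` is a locally principal (fractional) right `O`-ideal: an `𝓞 F`-lattice stable under right
multiplication by `O` with `Î = x Ô` for some `x ∈ D̂^×`. -/
structure IsLocallyPrincipal (O : Subalgebra (𝓞 F) (Quat a b))
    (I : Submodule (𝓞 F) (Quat a b)) : Prop where
  isLattice : Submodule.IsLattice F I
  mul_mem : ∀ y ∈ I, ∀ u ∈ O, y * u ∈ I
  locally_principal : ∃ x : (AdelicQuat a b)ˣ, (hat I : Set (AdelicQuat a b)) =
    (fun y => (x : AdelicQuat a b) * y) '' (hat (Subalgebra.toSubmodule O) : Set (AdelicQuat a b))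

/-- `I` and `I'` are in the same spinor class: `Î' = x Î` for some `x ∈ D^× D̂^1`. -/
def SameSpinorClass (I I' : Submodule (𝓞 F) (Quat a b)) : Prop :=
  ∃ x ∈ spinorUnits a b, (hat I' : Set (AdelicQuat a b)) =
    (fun y => (x : AdelicQuat a b) * y) '' (hat I : Set (AdelicQuat a b))

/-- `O` and `O'` are in the same spinor genus: `Ô' = x Ô x⁻¹` for some `x ∈ D^× D̂^1`. -/
def SameSpinorGenus (O O' : Subalgebra (𝓞 F) (Quat a b)) : Prop :=
  ∃ x ∈ spinorUnits a b, (hat (Subalgebra.toSubmodule O') : Set (AdelicQuat a b)) =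
    (fun y => (x : AdelicQuat a b) * y * (x⁻¹ : (AdelicQuat a b)ˣ)) ''
      (hat (Subalgebra.toSubmodule O) : Set (AdelicQuat a b))

/-- The class `[I] = {α I | α ∈ D^×}`. -/
def idealClass (I : Submodule (𝓞 F) (Quat a b)) : Set (Submodule (𝓞 F) (Quat a b)) :=
  {J | ∃ α : (Quat a b)ˣ,
    (J : Set (Quat a b)) = (fun y => (α : Quat a b) * y) '' (I : Set (Quat a b))}

/-- The type `⟦O⟧ = {α O α⁻¹ | α ∈ D^×}`. -/
def typeOf (O : Subalgebra (𝓞 F) (Quat a b)) : Set (Subalgebra (𝓞 F) (Quat a b)) :=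
  {O' | ∃ α : (Quat a b)ˣ, (O' : Set (Quat a b)) =
    (fun y => (α : Quat a b) * y * (α⁻¹ : (Quat a b)ˣ)) '' (O : Set (Quat a b))}

/-- The left order `{α ∈ D | α I ⊆ I}`. -/
def leftOrder (I : Submodule (𝓞 F) (Quat a b)) : Subalgebra (𝓞 F) (Quat a b) where
  carrier := {α | ∀ y ∈ I, α * y ∈ I}
  mul_mem' := by
    intro α β hα hβ y hy
    rw [mul_assoc]
    exact hα _ (hβ y hy)
  add_mem' := by
    intro α β hα hβ y hy
    rw [add_mul]
    exact I.add_mem (hα y hy) (hβ y hy)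
  algebraMap_mem' := by
    intro r y hy
    rw [← Algebra.smul_def]
    exact I.smul_mem r hy

/-- The locally principal right `O`-ideals in the spinor class of `O` itself. -/
def principalSpinorClass (O : Subalgebra (𝓞 F) (Quat a b)) :
    Set (Submodule (𝓞 F) (Quat a b)) :=
  {I | IsLocallyPrincipal O I ∧ SameSpinorClass (Subalgebra.toSubmodule O) I}

/-- The orders in the spinor genus of `O`. -/
def spinorGenus (O : Subalgebra (𝓞 F) (Quat a b)) : Set (Subalgebra (𝓞 F) (Quat a b)) :=
  {O' | IsOrder O' ∧ SameSpinorGenus O O'}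

/-- `Cl_sc(O)`: the ideal classes within the spinor class of `O`. -/
def ClSc (O : Subalgebra (𝓞 F) (Quat a b)) : Set (Set (Submodule (𝓞 F) (Quat a b))) :=
  idealClass '' principalSpinorClass O

/-- `Tp_sg(O)`: the types within the spinor genus of `O`. -/
def TpSg (O : Subalgebra (𝓞 F) (Quat a b)) : Set (Set (Subalgebra (𝓞 F) (Quat a b))) :=
  typeOf '' spinorGenus O

/-- The class number `h_sc(O)`, the cardinality of `Cl_sc(O)`. -/
def hSc (O : Subalgebra (𝓞 F) (Quat a b)) : ℕ∞ := (ClSc O).encard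

/-- The spinor type number of `O`, the cardinality of `Tp_sg(O)`. -/
def spinorTypeNumber (O : Subalgebra (𝓞 F) (Quat a b)) : ℕ∞ := (TpSg O).encard

end

end SpinorType

end

open IsDedekindDomain WithZero

open scoped Matrix

noncomputable section

namespace SpinorType

section
variable {F : Type*} [Field F] [NumberField F]

/-! ### Approximation in the ring of finite adeles -/

/-! An adelic dictionary underlies everything: $\Lambda\mapsto\widehat\Lambda$ and $M\mapsto M\cap
D$ are mutually inverse between lattices in $D$ and adelic lattices (`hat_globalPart`,
`globalPart_hat`). If $\widehat I=x\widehat{\mathbb O}$, the left order of $I$ is $D\cap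
x\widehat{\mathbb O}x^{-1}$. Hence $\Upsilon$ lands in the spinor genus. It is surjective, because
an order with completion $x\widehat{\mathbb O}x^{-1}$ is the left order of $D\cap x\widehat{\mathbb
O}$ (`exists_leftOrder_eq`). It is well defined because the left order of $\alpha I$ is
$\alpha\mathcal O_l(I)\alpha^{-1}$.

The substance is injectivity (`mem_idealClass_of_leftOrder_mem_typeOf`). Let $\widehat
I=x\widehat{\mathbb O}$, $\widehat J=y\widehat{\mathbb O}$ and $\mathcal O_l(J)=\alpha\mathcal
O_l(I)\alpha^{-1}$. Then $z=(\alpha x)^{-1}y$ normalizes $\widehat{\mathbb O}$. As $D$ splits at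
every finite place, each $\mathbb O_v$ is a copy of $M_2(O_{F_v})$, whose normalizer is $F_v^\times
GL_2(O_{F_v})$. So $\mathrm{Nr}(z)$ has even valuation everywhere, and $z$ lies in
$\gamma\widehat{\mathbb O}^\times$ as soon as $\mathrm{Nr}(z)$ has the valuations of $\gamma^2$ for
some $\gamma\in F^\times$ (`smul_mem_hat_of_normalizes`). In that case $J=\gamma\alpha I$.

The spinor condition makes $\mathrm{Nr}(z)$ the reduced norm $t$ of a global element, and total
definiteness makes $t$ totally positive. It remains to see that a totally positive $t\in\mathbb
Q(\sqrt p)$ generating the square of an ideal generates the square of a principal ideal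
(`isSqUpToUnits_of_totallyPositive`). Its norm is a rational square $n^2$, so
$t(\mathrm{Tr}\,t+2n)=(t+n)^2$ and $t$ may be replaced by a positive rational, then by a squarefree
integer $m$. The primes dividing $m$ must ramify. For $p$ this gives $(p)=(\sqrt p)^2$. The other
possibility is $2$ with $p\equiv3\bmod 4$, where Legendre's descent solves $x^2-py^2=\pm2$ and
$(2)=(x+y\sqrt p)^2$. -/

theorem valued_algebraMap (v : HeightOneSpectrum (𝓞 F)) (x : F) :
    Valued.v (algebraMap F (v.adicCompletion F) x) = v.valuation F x :=
  v.valuedAdicCompletion_eq_valuation' x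

/-- Density of $F$ in $F_v$ gives an approximation in $F$. It is automatically $v$-integral, so a
global integer approximates it in turn. -/
theorem exists_integer_sub_le (v : HeightOneSpectrum (𝓞 F)) {x : v.adicCompletion F}
    (hx : Valued.v x ≤ 1) {N : 𝓞 F} (hN : N ≠ 0) :
    ∃ d : 𝓞 F, Valued.v (x - algebraMap F (v.adicCompletion F) d) ≤ v.valuation F N := by
  have hN' : (N : F) ≠ 0 := by simpa using hN
  have hN1 : v.valuation F N ≠ 0 := by simpa using hN
  have hopen : IsOpen {y : v.adicCompletion F |
      (algebraMap F (v.adicCompletion F) N)⁻¹ * (x - y) ∈ v.adicCompletionIntegers F} :=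
    (Valued.isOpen_valuationSubring (v.adicCompletion F)).preimage (by fun_prop)
  obtain ⟨d, hd⟩ := (v.denseRange_algebraMap F).exists_mem_open hopen ⟨x, by simp⟩
  have hd : Valued.v (x - algebraMap F (v.adicCompletion F) d) ≤ v.valuation F N := by
    have := hd
    rw [Set.mem_ofPred_eq, HeightOneSpectrum.mem_adicCompletionIntegers, map_mul, map_inv₀,
      valued_algebraMap] at this
    rwa [inv_mul_le_iff₀ (zero_lt_iff.2 hN1), mul_one] at this
  have hd1 : v.valuation F d ≤ 1 := by
    rw [← valued_algebraMap, ← sub_sub_cancel x (algebraMap F (v.adicCompletion F) d)]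
    exact (Valuation.map_sub _ _ _).trans (max_le hx (hd.trans (v.valuation_le_one N)))
  obtain ⟨e, he⟩ := v.exists_valuation_sub_lt_of_integer hd1 (Units.mk0 _ hN1)
  refine ⟨e, ?_⟩
  rw [← sub_add_sub_cancel x (algebraMap F (v.adicCompletion F) d)]
  refine (Valuation.map_add _ _ _).trans (max_le hd ?_)
  rw [← map_sub, valued_algebraMap, Valuation.map_sub_swap]
  exact he.le

/-- An algebraic integer, as an integral finite adele. -/
def intEmb : 𝓞 F →+* integralAdeles F :=
  ((algebraMap F (FinAdele F)).comp (algebraMap (𝓞 F) F)).codRestrict _ fun r v => by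
    simpa using! v.coe_mem_adicCompletionIntegers (K := F) r

theorem algebraMap_finAdele_apply (x : F) (v : HeightOneSpectrum (𝓞 F)) :
    (algebraMap F (FinAdele F) x) v = algebraMap F (v.adicCompletion F) x := rfl

theorem finAdele_mul_apply (x y : FinAdele F) (v : HeightOneSpectrum (𝓞 F)) :
    (x * y) v = x v * y v := rfl

theorem finAdele_sub_apply (x y : FinAdele F) (v : HeightOneSpectrum (𝓞 F)) :
    (x - y) v = x v - y v := rfl

theorem algebraMap_mem_integralAdeles {x : F} :
    algebraMap F (FinAdele F) x ∈ integralAdeles F ↔ ∃ r : 𝓞 F, (r : F) = x := by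
  refine ⟨fun h => ?_, ?_⟩
  · refine HeightOneSpectrum.mem_integers_of_valuation_le_one F x fun v => ?_
    rw [← valued_algebraMap]
    exact h v
  · rintro ⟨r, rfl⟩
    exact (intEmb r).2

theorem finite_valuation_lt_one {N : 𝓞 F} (hN : N ≠ 0) :
    {v : HeightOneSpectrum (𝓞 F) | v.valuation F (N : F) < 1}.Finite := by
  simp_rw [HeightOneSpectrum.valuation_lt_one_iff_dvd]
  apply Ideal.finite_factors
  simpa only [Submodule.zero_eq_bot, ne_eq, Ideal.span_singleton_eq_bot]

/-- The Chinese remainder theorem glues the local approximations at the finitely many $v\mid N$. At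
the other places $N$ is a unit and integrality suffices. -/
theorem exists_integer_sub_mem {c : FinAdele F} (hc : c ∈ integralAdeles F) {N : 𝓞 F}
    (hN : N ≠ 0) :
    ∃ (d : 𝓞 F) (e : integralAdeles F), c = algebraMap F (FinAdele F) d +
      algebraMap F (FinAdele F) N * e := by
  classical
  have hN' : (N : F) ≠ 0 := by simpa using hN
  have hfin := finite_valuation_lt_one hN
  choose f hf using fun v : HeightOneSpectrum (𝓞 F) => exists_integer_sub_le v (hc v) hN
  let e : HeightOneSpectrum (𝓞 F) → ℕ := fun v => multiplicity v.asIdeal (Ideal.span {N})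
  have he : ∀ v : HeightOneSpectrum (𝓞 F),
      v.valuation F (N : F) = exp (-(e v : ℤ)) := fun v => by
    rw [HeightOneSpectrum.valuation_of_algebraMap, v.intValuation_eq_exp_neg_multiplicity hN]
  obtain ⟨d, hd⟩ := IsDedekindDomain.exists_forall_sub_mem_ideal (s := hfin.toFinset)
    (fun v : HeightOneSpectrum (𝓞 F) => v.asIdeal) e (fun v _ => v.prime)
    (fun v _ w _ hvw h => hvw (HeightOneSpectrum.ext h)) (fun v => f v)
  have key : ∀ v : HeightOneSpectrum (𝓞 F),
      Valued.v (c v - algebraMap F (v.adicCompletion F) d) ≤ v.valuation F (N : F) := by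
    intro v
    by_cases hv : v.valuation F (N : F) < 1
    · rw [← sub_add_sub_cancel (c v) (algebraMap F (v.adicCompletion F) (f v))]
      refine (Valuation.map_add _ _ _).trans (max_le (hf v) ?_)
      have := hd v (by simpa using hv)
      rw [← map_sub, valued_algebraMap, Valuation.map_sub_swap, he, ← map_sub,
        HeightOneSpectrum.valuation_of_algebraMap, HeightOneSpectrum.intValuation_le_pow_iff_mem]
      exact this
    · have h1 : v.valuation F (N : F) = 1 := le_antisymm (v.valuation_le_one N) (not_lt.1 hv)
      rw [h1]
      refine (Valuation.map_sub _ _ _).trans (max_le (hc v) ?_)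
      rw [valued_algebraMap]
      exact v.valuation_le_one d
  refine ⟨d, ⟨algebraMap F (FinAdele F) (N : F)⁻¹ * (c - algebraMap F (FinAdele F) d), ?_⟩, ?_⟩
  · intro v
    rw [finAdele_mul_apply, finAdele_sub_apply, algebraMap_finAdele_apply,
      algebraMap_finAdele_apply, HeightOneSpectrum.mem_adicCompletionIntegers, map_mul,
      valued_algebraMap, map_inv₀, inv_mul_le_iff₀ (zero_lt_iff.2 (by simpa using hN)), mul_one]
    exact key v
  · simp only
    rw [← mul_assoc, ← map_mul, mul_inv_cancel₀ hN', map_one, one_mul, add_sub_cancel]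

theorem exists_integer_mul_mem (c : FinAdele F) :
    ∃ N : 𝓞 F, N ≠ 0 ∧ algebraMap F (FinAdele F) N * c ∈ integralAdeles F := by
  classical
  have hfin : {v : HeightOneSpectrum (𝓞 F) | ¬ Valued.v (c v) ≤ 1}.Finite := c.2
  choose f hf0 hf using fun v : HeightOneSpectrum (𝓞 F) =>
    HeightOneSpectrum.adicCompletion.mul_nonZeroDivisor_mem_adicCompletionIntegers v (c v)
  refine ⟨∏ v ∈ hfin.toFinset, f v, Finset.prod_ne_zero_iff.2 fun v _ =>
    nonZeroDivisors.ne_zero (hf0 v), fun v => ?_⟩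
  have hint : ∀ r : 𝓞 F, algebraMap F (v.adicCompletion F) r ∈ v.adicCompletionIntegers F :=
    fun r => (intEmb r).2 v
  rw [finAdele_mul_apply, algebraMap_finAdele_apply]
  by_cases hv : Valued.v (c v) ≤ 1
  · exact mul_mem (hint _) hv
  · rw [← Finset.prod_erase_mul _ _ (hfin.mem_toFinset.2 hv)]
    change algebraMap F (v.adicCompletion F) (algebraMap (𝓞 F) F _) * _ ∈ _
    rw [map_mul, map_mul, mul_assoc]
    refine mul_mem (hint _) ?_
    rw [mul_comm]
    exact hf v

/-- Strong approximation for the additive group, $\widehat F=F+N\widehat O_F$: clear the denominator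
$r$ of $c$, approximate modulo $rN$, divide by $r$. -/
theorem exists_sub_mem (c : FinAdele F) {N : 𝓞 F} (hN : N ≠ 0) :
    ∃ (d : F) (e : integralAdeles F), c = algebraMap F (FinAdele F) d +
      algebraMap F (FinAdele F) N * e := by
  obtain ⟨r, hr, hrc⟩ := exists_integer_mul_mem c
  obtain ⟨d, e, h⟩ := exists_integer_sub_mem hrc (mul_ne_zero hr hN)
  have hr' : (r : F) ≠ 0 := by simpa using hr
  refine ⟨(r : F)⁻¹ * d, e, ?_⟩
  have hrN : ((r * N : 𝓞 F) : F) = r * N := rfl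
  rw [hrN, map_mul] at h
  have h1 : algebraMap F (FinAdele F) (r : F)⁻¹ * algebraMap F (FinAdele F) r = 1 := by
    rw [← map_mul, inv_mul_cancel₀ hr', map_one]
  rw [map_mul]
  linear_combination algebraMap F (FinAdele F) (r : F)⁻¹ * h -
    (c - algebraMap F (FinAdele F) N * e) * h1

end

section
variable {F : Type*} [Field F] [NumberField F] {a b : F}

/-! ### Lattices and adelic lattices in quaternion algebras -/

theorem toQuatOver_smul (N : 𝓞 F) (x : Quat a b) :
    toQuatOver (FinAdele F) a b (N • x) = intEmb N • toQuatOver (FinAdele F) a b x := by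
  have key : ∀ c : F, algebraMap F (FinAdele F) (N • c) = intEmb N • algebraMap F (FinAdele F) c :=
    fun c => by rw [Algebra.smul_def, map_mul]; rfl
  exact QuaternionAlgebra.ext (key _) (key _) (key _) (key _)

variable (a b) in
/-- The adelic quaternions with integral coordinates. -/
def stdHat : Submodule (integralAdeles F) (AdelicQuat a b) where
  carrier := {x | x.re ∈ integralAdeles F ∧ x.imI ∈ integralAdeles F ∧
    x.imJ ∈ integralAdeles F ∧ x.imK ∈ integralAdeles F}
  zero_mem' := ⟨zero_mem _, zero_mem _, zero_mem _, zero_mem _⟩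
  add_mem' hx hy := ⟨add_mem hx.1 hy.1, add_mem hx.2.1 hy.2.1, add_mem hx.2.2.1 hy.2.2.1,
    add_mem hx.2.2.2 hy.2.2.2⟩
  smul_mem' c _ hx := ⟨mul_mem c.2 hx.1, mul_mem c.2 hx.2.1, mul_mem c.2 hx.2.2.1,
    mul_mem c.2 hx.2.2.2⟩

/-- A submodule of the adelic quaternions commensurable with `stdHat`. -/
def IsAdelicLattice (M : Submodule (integralAdeles F) (AdelicQuat a b)) : Prop :=
  ∃ N : 𝓞 F, N ≠ 0 ∧ (∀ x ∈ stdHat a b, intEmb N • x ∈ M) ∧ ∀ x ∈ M, intEmb N • x ∈ stdHat a b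

/-- The elements of the quaternion algebra lying in a given adelic submodule. -/
def globalPart (M : Submodule (integralAdeles F) (AdelicQuat a b)) :
    Submodule (𝓞 F) (Quat a b) where
  carrier := {x | toQuatOver (FinAdele F) a b x ∈ M}
  zero_mem' := by simp
  add_mem' hx hy := by
    rw [Set.mem_ofPred_eq, map_add]
    exact M.add_mem hx hy
  smul_mem' c x hx := by
    rw [Set.mem_ofPred_eq, toQuatOver_smul]
    exact M.smul_mem _ hx

theorem mem_globalPart {M : Submodule (integralAdeles F) (AdelicQuat a b)} {x : Quat a b} :
    x ∈ globalPart M ↔ toQuatOver (FinAdele F) a b x ∈ M := Iff.rfl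

theorem toQuatOver_mem_hat {I : Submodule (𝓞 F) (Quat a b)} {x : Quat a b} (hx : x ∈ I) :
    toQuatOver (FinAdele F) a b x ∈ hat I :=
  Submodule.subset_span ⟨x, hx, rfl⟩

/-- The standard basis of a quaternion algebra. -/
def stdBasis {R : Type*} [CommRing R] (a b : R) : Fin 4 → ℍ[R, a, b] :=
  ![⟨1, 0, 0, 0⟩, ⟨0, 1, 0, 0⟩, ⟨0, 0, 1, 0⟩, ⟨0, 0, 0, 1⟩]

theorem sum_smul_stdBasis {R : Type*} [CommRing R] {a b : R} (x : ℍ[R, a, b]) :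
    x.re • stdBasis a b 0 + x.imI • stdBasis a b 1 + x.imJ • stdBasis a b 2 +
      x.imK • stdBasis a b 3 = x := by
  ext <;> simp [stdBasis]

theorem toQuatOver_stdBasis (i : Fin 4) :
    toQuatOver (FinAdele F) a b (stdBasis a b i) = stdBasis _ _ i := by
  fin_cases i <;> ext <;> simp [stdBasis, toQuatOver]

theorem stdHat_le {M : Submodule (integralAdeles F) (AdelicQuat a b)} {N : integralAdeles F}
    (h : ∀ i, N • stdBasis _ _ i ∈ M) {x : AdelicQuat a b} (hx : x ∈ stdHat a b) :
    N • x ∈ M := by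
  obtain ⟨h1, h2, h3, h4⟩ := hx
  rw [← sum_smul_stdBasis x, smul_add, smul_add, smul_add]
  have key : ∀ {c : FinAdele F} (hc : c ∈ integralAdeles F) (i : Fin 4),
      N • c • stdBasis (algebraMap F (FinAdele F) a) (algebraMap F (FinAdele F) b) i ∈ M := by
    intro c hc i
    have := M.smul_mem ⟨c, hc⟩ (h i)
    rw [smul_comm] at this
    exact this
  exact add_mem (add_mem (add_mem (key h1 0) (key h2 1)) (key h3 2)) (key h4 3)

theorem stdBasis_mem_stdHat (i : Fin 4) : stdBasis _ _ i ∈ stdHat a b := by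
  fin_cases i <;> simp [stdBasis, stdHat, zero_mem, one_mem]

theorem exists_sub_mem_quat (x : AdelicQuat a b) {N : 𝓞 F} (hN : N ≠ 0) :
    ∃ d : Quat a b, ∃ e ∈ stdHat a b, x = toQuatOver (FinAdele F) a b d + intEmb N • e := by
  obtain ⟨d1, e1, h1⟩ := exists_sub_mem x.re hN
  obtain ⟨d2, e2, h2⟩ := exists_sub_mem x.imI hN
  obtain ⟨d3, e3, h3⟩ := exists_sub_mem x.imJ hN
  obtain ⟨d4, e4, h4⟩ := exists_sub_mem x.imK hN
  exact ⟨⟨d1, d2, d3, d4⟩, ⟨e1, e2, e3, e4⟩, ⟨e1.2, e2.2, e3.2, e4.2⟩,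
    QuaternionAlgebra.ext h1 h2 h3 h4⟩

/-- If $N$ times the standard lattice lies in $M$, write $x\in M$ as $d+Ne$ with $d\in D$ and $e$
integral. Then $d=x-Ne$ lies in $M\cap D$, and $Ne$ is an integral combination of the global
elements $N\cdot1,Ni,Nj,Nij$ of $M$. -/
theorem hat_globalPart {M : Submodule (integralAdeles F) (AdelicQuat a b)}
    (hM : IsAdelicLattice M) : hat (globalPart M) = M := by
  apply le_antisymm
  · rw [hat, Submodule.span_le]
    rintro _ ⟨x, hx, rfl⟩
    exact hx
  · obtain ⟨N, hN, h1, -⟩ := hM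
    intro x hx
    obtain ⟨d, e, he, rfl⟩ := exists_sub_mem_quat x hN
    have hd : d ∈ globalPart M := by
      have := M.sub_mem hx (h1 e he)
      rwa [add_sub_cancel_right] at this
    refine add_mem (toQuatOver_mem_hat hd) (stdHat_le (fun i => ?_) he)
    rw [← toQuatOver_stdBasis, ← toQuatOver_smul]
    apply toQuatOver_mem_hat
    rw [mem_globalPart, toQuatOver_smul, toQuatOver_stdBasis]
    exact h1 _ (stdBasis_mem_stdHat i)

theorem exists_integer_smul_mem_stdHat (x : AdelicQuat a b) :
    ∃ N : 𝓞 F, N ≠ 0 ∧ intEmb N • x ∈ stdHat a b := by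
  obtain ⟨n1, h1, h1'⟩ := exists_integer_mul_mem x.re
  obtain ⟨n2, h2, h2'⟩ := exists_integer_mul_mem x.imI
  obtain ⟨n3, h3, h3'⟩ := exists_integer_mul_mem x.imJ
  obtain ⟨n4, h4, h4'⟩ := exists_integer_mul_mem x.imK
  refine ⟨n1 * n2 * n3 * n4, by simp_all, ?_⟩
  have key : ∀ (m n : 𝓞 F) (c : FinAdele F), algebraMap F (FinAdele F) n * c ∈ integralAdeles F →
      ((intEmb (m * n) : integralAdeles F) : FinAdele F) * c ∈ integralAdeles F := by
    intro m n c h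
    rw [map_mul, Subring.coe_mul, mul_assoc]
    exact mul_mem (intEmb m).2 h
  refine ⟨?_, ?_, ?_, ?_⟩
  · rw [show n1 * n2 * n3 * n4 = n2 * n3 * n4 * n1 by ring]
    exact key _ _ _ h1'
  · rw [show n1 * n2 * n3 * n4 = n1 * n3 * n4 * n2 by ring]
    exact key _ _ _ h2'
  · rw [show n1 * n2 * n3 * n4 = n1 * n2 * n4 * n3 by ring]
    exact key _ _ _ h3'
  · exact key _ _ _ h4'

theorem exists_integer_smul_mem_stdHat_finset {ι : Type*} (s : Finset ι) (f : ι → AdelicQuat a b) :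
    ∃ N : 𝓞 F, N ≠ 0 ∧ ∀ i ∈ s, intEmb N • f i ∈ stdHat a b := by
  classical
  choose g h0 hg using fun i => exists_integer_smul_mem_stdHat (f i)
  refine ⟨∏ i ∈ s, g i, Finset.prod_ne_zero_iff.2 fun i _ => h0 i, fun i hi => ?_⟩
  rw [← Finset.prod_erase_mul _ _ hi, map_mul, mul_smul]
  exact Submodule.smul_mem _ _ (hg i)

theorem exists_integer_smul_mem_of_mem_span {I : Submodule (𝓞 F) (Quat a b)} {x : Quat a b}
    (hx : x ∈ Submodule.span F (I : Set (Quat a b))) : ∃ N : 𝓞 F, N ≠ 0 ∧ N • x ∈ I := by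
  induction hx using Submodule.span_induction with
  | mem x h => exact ⟨1, one_ne_zero, by simpa using h⟩
  | zero => exact ⟨1, one_ne_zero, by simp⟩
  | add x y _ _ hx hy =>
    obtain ⟨m, hm, hx⟩ := hx
    obtain ⟨n, hn, hy⟩ := hy
    refine ⟨m * n, mul_ne_zero hm hn, ?_⟩
    rw [smul_add, mul_comm, mul_smul, mul_comm, mul_smul]
    exact add_mem (I.smul_mem _ hx) (I.smul_mem _ hy)
  | smul c x _ hx =>
    obtain ⟨m, hm, hx⟩ := hx
    obtain ⟨r, s, hs, rfl⟩ := IsFractionRing.div_surjective (A := 𝓞 F) c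
    have hs0 := nonZeroDivisors.ne_zero hs
    refine ⟨s * m, mul_ne_zero hs0 hm, ?_⟩
    have h2 : (s * m) • (algebraMap (𝓞 F) F r / algebraMap (𝓞 F) F s) • x = r • m • x := by
      rw [← algebraMap_smul F, ← algebraMap_smul F r, ← algebraMap_smul F m, smul_smul, smul_smul,
        map_mul]
      congr 1
      have : algebraMap (𝓞 F) F s ≠ 0 := by simpa using hs0
      field_simp
    rw [h2]
    exact I.smul_mem _ hx

theorem isAdelicLattice_hat {I : Submodule (𝓞 F) (Quat a b)} (hI : I.IsLattice F) :
    IsAdelicLattice (hat I) := by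
  obtain ⟨s, hs⟩ := hI.fg
  obtain ⟨N, hN, hNs⟩ := exists_integer_smul_mem_stdHat_finset s (toQuatOver (FinAdele F) a b)
  choose g hg0 hg using fun i => exists_integer_smul_mem_of_mem_span
    (show stdBasis a b i ∈ Submodule.span F (I : Set (Quat a b)) by
      rw [hI.span_eq_top]; trivial)
  -- $N$ clears the denominators of the generators of $I$, and $g_i$ brings the $i$-th basis vector
  -- into $I$. The product serves both inclusions.
  refine ⟨N * ∏ i, g i, mul_ne_zero hN (Finset.prod_ne_zero_iff.2 fun i _ => hg0 i), ?_, ?_⟩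
  · intro x hx
    refine stdHat_le (fun i => ?_) hx
    rw [← toQuatOver_stdBasis, ← toQuatOver_smul]
    apply toQuatOver_mem_hat
    rw [← Finset.prod_erase_mul _ _ (Finset.mem_univ i), ← mul_assoc, mul_smul]
    exact I.smul_mem _ (hg i)
  · intro x hx
    rw [mul_comm, map_mul, mul_smul]
    refine Submodule.smul_mem _ _ ?_
    have hle : hat I ≤ (stdHat a b).comap (LinearMap.lsmul (integralAdeles F) _ (intEmb N)) := by
      rw [hat, Submodule.span_le]
      rintro _ ⟨y, hy, rfl⟩
      rw [SetLike.mem_coe, ← hs] at hy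
      induction hy using Submodule.span_induction with
      | mem y h => exact hNs y h
      | zero => simp
      | add x y _ _ hx hy =>
        rw [map_add]
        exact add_mem hx hy
      | smul c x _ hx =>
        rw [toQuatOver_smul]
        exact Submodule.smul_mem _ _ hx
    exact hle hx

/-- After division by $N$, the coordinates are elements of $F$ integral at every finite place, hence
algebraic integers. -/
theorem toQuatOver_mem_smul_stdHat {N : 𝓞 F} {x : Quat a b} {e : AdelicQuat a b}
    (hN : N ≠ 0) (he : e ∈ stdHat a b)
    (h : toQuatOver (FinAdele F) a b x = intEmb N • e) :
    ∃ r : Fin 4 → 𝓞 F, x = N • ∑ i, r i • stdBasis a b i := by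
  have hN' : (N : F) ≠ 0 := by simpa using hN
  have key : ∀ {c : F} {e : FinAdele F}, e ∈ integralAdeles F →
      algebraMap F (FinAdele F) c = algebraMap F (FinAdele F) N * e → ∃ r : 𝓞 F, N * r = c := by
    intro c e he h
    have : algebraMap F (FinAdele F) ((N : F)⁻¹ * c) = e := by
      rw [map_mul, h, ← mul_assoc, ← map_mul, inv_mul_cancel₀ hN', map_one, one_mul]
    rw [← this, algebraMap_mem_integralAdeles] at he
    obtain ⟨r, hr⟩ := he
    exact ⟨r, by rw [hr, mul_inv_cancel_left₀ hN']⟩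
  obtain ⟨r1, h1⟩ := key he.1 (congrArg QuaternionAlgebra.re h)
  obtain ⟨r2, h2⟩ := key he.2.1 (congrArg QuaternionAlgebra.imI h)
  obtain ⟨r3, h3⟩ := key he.2.2.1 (congrArg QuaternionAlgebra.imJ h)
  obtain ⟨r4, h4⟩ := key he.2.2.2 (congrArg QuaternionAlgebra.imK h)
  refine ⟨![r1, r2, r3, r4], ?_⟩
  ext
  · simp [Fin.sum_univ_four, stdBasis, Algebra.smul_def, ← h1]
  · simp [Fin.sum_univ_four, stdBasis, Algebra.smul_def, ← h2]
  · simp [Fin.sum_univ_four, stdBasis, Algebra.smul_def, ← h3]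
  · simp [Fin.sum_univ_four, stdBasis, Algebra.smul_def, ← h4]

/-- With $P=\prod g_i$ chosen so that $P$ carries the standard basis into $I$, every element of
$\widehat I$ is an element of $I$ plus $P$ times an integral adelic quaternion. For a global element
that error term is itself global, so it lies in $I$. -/
theorem globalPart_hat {I : Submodule (𝓞 F) (Quat a b)} (hI : I.IsLattice F) :
    globalPart (hat I) = I := by
  apply le_antisymm
  · obtain ⟨N, hN, h1, h2⟩ := isAdelicLattice_hat hI
    choose g hg0 hg using fun i => exists_integer_smul_mem_of_mem_span
      (show stdBasis a b i ∈ Submodule.span F (I : Set (Quat a b)) by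
        rw [hI.span_eq_top]; trivial)
    have hP : (∏ i, g i) ≠ 0 := Finset.prod_ne_zero_iff.2 fun i _ => hg0 i
    have hmem : ∀ x : Quat a b, ∀ e ∈ stdHat a b,
        toQuatOver (FinAdele F) a b x = intEmb (∏ i, g i) • e → x ∈ I := by
      intro x e he h
      obtain ⟨r, rfl⟩ := toQuatOver_mem_smul_stdHat hP he h
      rw [Finset.smul_sum]
      refine sum_mem fun i _ => ?_
      rw [smul_comm]
      refine I.smul_mem _ ?_
      rw [← Finset.prod_erase_mul _ _ (Finset.mem_univ i), mul_smul]
      exact I.smul_mem _ (hg i)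
    have key : ∀ y ∈ hat I, ∃ z ∈ I, ∃ e ∈ stdHat a b,
        y = toQuatOver (FinAdele F) a b z + intEmb (∏ i, g i) • e := by
      intro y hy
      induction hy using Submodule.span_induction with
      | mem y h =>
        obtain ⟨z, hz, rfl⟩ := h
        exact ⟨z, hz, 0, zero_mem _, by simp⟩
      | zero => exact ⟨0, zero_mem _, 0, zero_mem _, by simp⟩
      | add x y _ _ hx hy =>
        obtain ⟨z, hz, e, he, rfl⟩ := hx
        obtain ⟨z', hz', e', he', rfl⟩ := hy
        refine ⟨z + z', add_mem hz hz', e + e', add_mem he he', ?_⟩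
        rw [map_add, smul_add]
        abel
      | smul c x _ hx =>
        obtain ⟨z, hz, e, he, rfl⟩ := hx
        -- The modulus is $PN$ because $z$ need not be integral: in $cz=dz+P\,f(Nz)$, the factor $N$
        -- makes $Nz$ integral.
        obtain ⟨d, f, hdf⟩ := exists_integer_sub_mem c.2 (mul_ne_zero hP hN)
        have hdf' : c = intEmb d + intEmb ((∏ i, g i) * N) * f := Subtype.ext hdf
        refine ⟨d • z, I.smul_mem _ hz, f • (intEmb N • toQuatOver (FinAdele F) a b z) + c • e,
          add_mem (Submodule.smul_mem _ _ (h2 _ (toQuatOver_mem_hat hz)))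
            (Submodule.smul_mem _ _ he), ?_⟩
        rw [toQuatOver_smul, smul_add, smul_add, smul_comm _ c e, ← add_assoc]
        congr 1
        conv_lhs => rw [hdf']
        rw [add_smul, smul_smul, smul_smul, map_mul]
        congr 2
        ring
    intro x hx
    obtain ⟨z, hz, e, he, h⟩ := key _ hx
    have := hmem (x - z) e he (by rw [map_sub, h, add_sub_cancel_left])
    simpa using add_mem this hz
  · exact fun x hx => toQuatOver_mem_hat hx

/-- The global part sits inside $N^{-1}$ times the standard lattice, a Noetherian module, and
contains $N$ times the standard basis. -/
theorem isLattice_globalPart {M : Submodule (integralAdeles F) (AdelicQuat a b)}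
    (hM : IsAdelicLattice M) : (globalPart M).IsLattice F := by
  obtain ⟨N, hN, h1, h2⟩ := hM
  have hN' : (N : F) ≠ 0 := by simpa using hN
  constructor
  · have hle : globalPart M ≤ Submodule.span (𝓞 F)
        (Set.range fun i => (N : F)⁻¹ • stdBasis a b i) := by
      intro x hx
      obtain ⟨r, hr⟩ := toQuatOver_mem_smul_stdHat (a := a) (b := b) (N := 1)
        (x := N • x) one_ne_zero (h2 _ hx) (by rw [toQuatOver_smul, map_one, one_smul])
      have : x = ∑ i, r i • (N : F)⁻¹ • stdBasis a b i := by
        rw [one_smul, ← algebraMap_smul F] at hr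
        rw [eq_comm, ← inv_smul_eq_iff₀ hN', Finset.smul_sum] at hr
        rw [← hr]
        exact Finset.sum_congr rfl fun i _ => smul_comm _ _ _
      rw [this]
      exact sum_mem fun i _ => Submodule.smul_mem _ _ (Submodule.subset_span ⟨i, rfl⟩)
    have : IsNoetherian (𝓞 F) (Submodule.span (𝓞 F)
        (Set.range fun i => (N : F)⁻¹ • stdBasis a b i)) :=
      isNoetherian_span_of_finite _ (Set.finite_range _)
    exact Submodule.FG.of_le_of_isNoetherian hle
  · rw [eq_top_iff]
    intro x _
    have hb : ∀ i, stdBasis a b i ∈ Submodule.span F (globalPart M : Set (Quat a b)) := by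
      intro i
      have : N • stdBasis a b i ∈ globalPart M := by
        rw [mem_globalPart, toQuatOver_smul, toQuatOver_stdBasis]
        exact h1 _ (stdBasis_mem_stdHat i)
      have h3 := Submodule.smul_mem _ (N : F)⁻¹ (Submodule.subset_span (R := F) this)
      rwa [← algebraMap_smul F N, inv_smul_smul₀ hN'] at h3
    rw [← sum_smul_stdBasis x]
    exact add_mem (add_mem (add_mem (Submodule.smul_mem _ _ (hb 0)) (Submodule.smul_mem _ _ (hb 1)))
      (Submodule.smul_mem _ _ (hb 2))) (Submodule.smul_mem _ _ (hb 3))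

end

section
variable {F : Type*} [Field F] [NumberField F] {a b : F}

/-! ### Local components -/

/-- The component of a finite adele at `v`. -/
def evalHom (v : HeightOneSpectrum (𝓞 F)) : FinAdele F →+* v.adicCompletion F where
  toFun x := x v
  map_one' := rfl
  map_mul' _ _ := rfl
  map_zero' := rfl
  map_add' _ _ := rfl

@[simp]
theorem evalHom_algebraMap (v : HeightOneSpectrum (𝓞 F)) (x : F) :
    evalHom v (algebraMap F (FinAdele F) x) = algebraMap F (v.adicCompletion F) x := rfl

theorem finAdele_ext {x y : FinAdele F} (h : ∀ v, evalHom v x = evalHom v y) : x = y :=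
  FiniteAdeleRing.ext F h

theorem mem_integralAdeles_iff_evalHom {x : FinAdele F} :
    x ∈ integralAdeles F ↔ ∀ v, evalHom v x ∈ v.adicCompletionIntegers F := Iff.rfl

/-- The component of an adelic quaternion at `v`. -/
def proj (v : HeightOneSpectrum (𝓞 F)) : AdelicQuat a b →+* QuatOver (v.adicCompletion F) a b where
  toFun x := ⟨evalHom v x.re, evalHom v x.imI, evalHom v x.imJ, evalHom v x.imK⟩
  map_one' := by ext1 <;> simp
  map_mul' x y := by ext1 <;> simp
  map_zero' := by ext1 <;> simp
  map_add' x y := by ext1 <;> simp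

theorem proj_smul_field (v : HeightOneSpectrum (𝓞 F)) (c : FinAdele F) (x : AdelicQuat a b) :
    proj v (c • x) = evalHom v c • proj v x := by
  have h : ∀ y : FinAdele F, evalHom v (c • y) = evalHom v c * evalHom v y :=
    fun y => map_mul (evalHom v) c y
  exact QuaternionAlgebra.ext (h _) (h _) (h _) (h _)

theorem proj_smul (v : HeightOneSpectrum (𝓞 F)) (c : integralAdeles F) (x : AdelicQuat a b) :
    proj v (c • x) = evalHom v c • proj v x := proj_smul_field v c x

theorem adelicQuat_ext {x y : AdelicQuat a b} (h : ∀ v, proj v x = proj v y) : x = y := by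
  refine QuaternionAlgebra.ext ?_ ?_ ?_ ?_ <;> refine finAdele_ext fun v => ?_
  · exact congrArg QuaternionAlgebra.re (h v)
  · exact congrArg QuaternionAlgebra.imI (h v)
  · exact congrArg QuaternionAlgebra.imJ (h v)
  · exact congrArg QuaternionAlgebra.imK (h v)

/-- The local quaternions with integral coordinates. -/
def IsStdIntegral (v : HeightOneSpectrum (𝓞 F)) (x : QuatOver (v.adicCompletion F) a b) : Prop :=
  x.re ∈ v.adicCompletionIntegers F ∧ x.imI ∈ v.adicCompletionIntegers F ∧
    x.imJ ∈ v.adicCompletionIntegers F ∧ x.imK ∈ v.adicCompletionIntegers F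

theorem mem_stdHat_iff {x : AdelicQuat a b} :
    x ∈ stdHat a b ↔ ∀ v, IsStdIntegral v (proj v x) :=
  ⟨fun h v => ⟨h.1 v, h.2.1 v, h.2.2.1 v, h.2.2.2 v⟩,
    fun h => ⟨fun v => (h v).1, fun v => (h v).2.1, fun v => (h v).2.2.1, fun v => (h v).2.2.2⟩⟩

open Classical in
/-- The integral adele equal to `1` on `S` and to `0` off `S`. -/
def indicatorAdele (S : Set (HeightOneSpectrum (𝓞 F))) : integralAdeles F :=
  ⟨⟨fun w => if w ∈ S then 1 else 0, Filter.Eventually.of_forall fun w => by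
    simp only; split_ifs; exacts [one_mem _, zero_mem _]⟩, fun w => by
    change (if w ∈ S then 1 else 0) ∈ _
    split_ifs; exacts [one_mem _, zero_mem _]⟩

theorem evalHom_indicatorAdele_of_mem {S : Set (HeightOneSpectrum (𝓞 F))} {w} (h : w ∈ S) :
    evalHom w (indicatorAdele S : FinAdele F) = 1 := if_pos h

theorem evalHom_indicatorAdele_of_notMem {S : Set (HeightOneSpectrum (𝓞 F))} {w} (h : w ∉ S) :
    evalHom w (indicatorAdele S : FinAdele F) = 0 := if_neg h

open Classical in
/-- The finite adele supported at `v` with component `c` there. -/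
def singleAdele (v : HeightOneSpectrum (𝓞 F)) (c : v.adicCompletion F) : FinAdele F :=
  ⟨fun w => Pi.single (M := fun w : HeightOneSpectrum (𝓞 F) => w.adicCompletion F) v c w, by
    refine (Set.finite_singleton v).subset fun w hw => ?_
    by_contra hwv
    refine hw ?_
    have : Pi.single (M := fun w : HeightOneSpectrum (𝓞 F) => w.adicCompletion F) v c w = 0 :=
      Pi.single_eq_of_ne hwv c
    change Pi.single (M := fun w : HeightOneSpectrum (𝓞 F) => w.adicCompletion F) v c w ∈
      w.adicCompletionIntegers F
    rw [this]
    exact zero_mem (w.adicCompletionIntegers F)⟩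

open Classical in
theorem evalHom_singleAdele (v : HeightOneSpectrum (𝓞 F)) (c : v.adicCompletion F) :
    evalHom v (singleAdele v c) = c :=
  Pi.single_eq_same (M := fun w : HeightOneSpectrum (𝓞 F) => w.adicCompletion F) v c

open Classical in
theorem evalHom_singleAdele_of_ne {v w : HeightOneSpectrum (𝓞 F)} (h : w ≠ v)
    (c : v.adicCompletion F) : evalHom w (singleAdele v c) = 0 :=
  Pi.single_eq_of_ne (M := fun w : HeightOneSpectrum (𝓞 F) => w.adicCompletion F) h c

theorem singleAdele_mem {v : HeightOneSpectrum (𝓞 F)} {c : v.adicCompletion F}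
    (hc : c ∈ v.adicCompletionIntegers F) : singleAdele v c ∈ integralAdeles F := by
  rw [mem_integralAdeles_iff_evalHom]
  intro w
  by_cases h : w = v
  · subst h
    rwa [evalHom_singleAdele]
  · rw [evalHom_singleAdele_of_ne h]
    exact zero_mem _

/-- The adelic quaternion supported at `v` with component `x` there. -/
def singleQuat (v : HeightOneSpectrum (𝓞 F)) (x : QuatOver (v.adicCompletion F) a b) :
    AdelicQuat a b :=
  ⟨singleAdele v x.re, singleAdele v x.imI, singleAdele v x.imJ, singleAdele v x.imK⟩

theorem proj_singleQuat (v : HeightOneSpectrum (𝓞 F)) (x : QuatOver (v.adicCompletion F) a b) :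
    proj v (singleQuat v x) = x :=
  QuaternionAlgebra.ext (evalHom_singleAdele _ _) (evalHom_singleAdele _ _)
    (evalHom_singleAdele _ _) (evalHom_singleAdele _ _)

theorem proj_singleQuat_of_ne {v w : HeightOneSpectrum (𝓞 F)} (h : w ≠ v)
    (x : QuatOver (v.adicCompletion F) a b) : proj w (singleQuat v x) = 0 :=
  QuaternionAlgebra.ext (evalHom_singleAdele_of_ne h _) (evalHom_singleAdele_of_ne h _)
    (evalHom_singleAdele_of_ne h _) (evalHom_singleAdele_of_ne h _)

/-- The component at `v` of a submodule of the adelic quaternions. -/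
def localPart (v : HeightOneSpectrum (𝓞 F)) (M : Submodule (integralAdeles F) (AdelicQuat a b)) :
    Submodule (v.adicCompletionIntegers F) (QuatOver (v.adicCompletion F) a b) where
  carrier := proj v '' M
  zero_mem' := ⟨0, zero_mem _, map_zero _⟩
  add_mem' := by
    rintro _ _ ⟨x, hx, rfl⟩ ⟨y, hy, rfl⟩
    exact ⟨x + y, add_mem hx hy, map_add _ _ _⟩
  smul_mem' := by
    rintro c _ ⟨x, hx, rfl⟩
    refine ⟨(⟨_, singleAdele_mem c.2⟩ : integralAdeles F) • x, M.smul_mem _ hx, ?_⟩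
    rw [proj_smul, evalHom_singleAdele]
    rfl

theorem proj_mem_localPart {v : HeightOneSpectrum (𝓞 F)}
    {M : Submodule (integralAdeles F) (AdelicQuat a b)} {x : AdelicQuat a b} (hx : x ∈ M) :
    proj v x ∈ localPart v M := ⟨x, hx, rfl⟩

/-- The indicator of a place is an integral adele, so finitely many local witnesses in $M$ can be
cut out and added up. -/
theorem indicatorAdele_smul_mem {M : Submodule (integralAdeles F) (AdelicQuat a b)}
    {S : Set (HeightOneSpectrum (𝓞 F))} (hS : S.Finite) {x : AdelicQuat a b}
    (h : ∀ v ∈ S, proj v x ∈ localPart v M) : indicatorAdele S • x ∈ M := by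
  induction S, hS using Set.Finite.induction_on with
  | empty =>
    convert M.zero_mem
    refine adelicQuat_ext fun w => ?_
    rw [proj_smul, evalHom_indicatorAdele_of_notMem (Set.notMem_empty w), zero_smul, map_zero]
  | @insert v S hv hS ih =>
    obtain ⟨y, hy, hyx⟩ := h v (Set.mem_insert v S)
    have : indicatorAdele (insert v S) • x = indicatorAdele {v} • y + indicatorAdele S • x := by
      refine adelicQuat_ext fun w => ?_
      rw [map_add, proj_smul, proj_smul, proj_smul]
      by_cases hwv : w = v
      · subst hwv
        rw [evalHom_indicatorAdele_of_mem (Set.mem_insert w S),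
          evalHom_indicatorAdele_of_mem (Set.mem_singleton w),
          evalHom_indicatorAdele_of_notMem hv, hyx, zero_smul, add_zero]
      · rw [evalHom_indicatorAdele_of_notMem (S := {v}) hwv, zero_smul, zero_add]
        by_cases hw : w ∈ S
        · rw [evalHom_indicatorAdele_of_mem hw,
            evalHom_indicatorAdele_of_mem (Set.mem_insert_of_mem v hw)]
        · rw [evalHom_indicatorAdele_of_notMem hw, evalHom_indicatorAdele_of_notMem]
          simp [hwv, hw]
    rw [this]
    exact add_mem (M.smul_mem _ hy) (ih fun w hw => h w (Set.mem_insert_of_mem v hw))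

theorem finite_notMem_integers (c : FinAdele F) :
    {v | evalHom v c ∉ v.adicCompletionIntegers F}.Finite := c.2

/-- Outside a finite set $S$, the coordinates of $x$ are integral and $N$ is a unit, so that part of
$x$ lies in $N$ times the standard lattice, hence in $M$. The part on $S$ is assembled from finitely
many local components. -/
theorem mem_of_forall_proj_mem {M : Submodule (integralAdeles F) (AdelicQuat a b)}
    (hM : IsAdelicLattice M) {x : AdelicQuat a b} (h : ∀ v, proj v x ∈ localPart v M) : x ∈ M := by
  obtain ⟨N, hN, h1, -⟩ := hM
  have hN' : (N : F) ≠ 0 := by simpa using hN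
  let S : Set (HeightOneSpectrum (𝓞 F)) := {v | v.valuation F (N : F) < 1} ∪
    ({v | evalHom v x.re ∉ v.adicCompletionIntegers F} ∪
      ({v | evalHom v x.imI ∉ v.adicCompletionIntegers F} ∪
        ({v | evalHom v x.imJ ∉ v.adicCompletionIntegers F} ∪
          {v | evalHom v x.imK ∉ v.adicCompletionIntegers F})))
  have hS : S.Finite := (finite_valuation_lt_one hN).union ((finite_notMem_integers _).union
    ((finite_notMem_integers _).union ((finite_notMem_integers _).union
      (finite_notMem_integers _))))
  have hxS : x = indicatorAdele S • x + indicatorAdele Sᶜ • x := by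
    refine adelicQuat_ext fun w => ?_
    rw [map_add, proj_smul, proj_smul]
    by_cases hw : w ∈ S
    · rw [evalHom_indicatorAdele_of_mem hw,
        evalHom_indicatorAdele_of_notMem (S := Sᶜ) (by simpa using hw), one_smul, zero_smul, add_zero]
    · rw [evalHom_indicatorAdele_of_notMem hw,
        evalHom_indicatorAdele_of_mem (S := Sᶜ) hw, one_smul, zero_smul, zero_add]
  rw [hxS]
  refine add_mem (indicatorAdele_smul_mem hS fun v _ => h v) ?_
  have key : ∀ c : FinAdele F, (∀ w ∉ S, evalHom w c ∈ w.adicCompletionIntegers F) →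
      algebraMap F (FinAdele F) (N : F)⁻¹ * ((indicatorAdele Sᶜ : FinAdele F) * c) ∈
        integralAdeles F := by
    intro c hc
    rw [mem_integralAdeles_iff_evalHom]
    intro w
    rw [map_mul, map_mul]
    by_cases hw : w ∈ S
    · rw [evalHom_indicatorAdele_of_notMem (S := Sᶜ) (by simpa using hw), zero_mul, mul_zero]
      exact zero_mem _
    · rw [evalHom_indicatorAdele_of_mem (S := Sᶜ) hw, one_mul]
      refine mul_mem ?_ (hc w hw)
      have : w.valuation F (N : F) = 1 :=
        le_antisymm (w.valuation_le_one N) (not_lt.1 fun h => hw (Or.inl h))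
      rw [evalHom_algebraMap, HeightOneSpectrum.mem_adicCompletionIntegers, valued_algebraMap,
        map_inv₀, this, inv_one]
  have hcan : ∀ c : FinAdele F, (indicatorAdele Sᶜ : FinAdele F) * c =
      algebraMap F (FinAdele F) N * (algebraMap F (FinAdele F) (N : F)⁻¹ *
        ((indicatorAdele Sᶜ : FinAdele F) * c)) := fun c => by
    rw [← mul_assoc, ← map_mul, mul_inv_cancel₀ hN', map_one, one_mul]
  have hout : ∀ w ∉ S, IsStdIntegral w (proj w x) := by
    intro w hw
    simp only [S, Set.mem_union, Set.mem_ofPred_eq, not_or, not_not] at hw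
    exact hw.2
  have := h1 ⟨_, _, _, _⟩ ⟨key x.re fun w hw => (hout w hw).1, key x.imI fun w hw => (hout w hw).2.1,
    key x.imJ fun w hw => (hout w hw).2.2.1, key x.imK fun w hw => (hout w hw).2.2.2⟩
  convert this using 1
  exact QuaternionAlgebra.ext (hcan _) (hcan _) (hcan _) (hcan _)

end

section

/-! ### Matrix algebras over fields with a valuation -/

theorem nr_eq {R : Type*} [CommRing R] {a b : R} (x : ℍ[R, a, b]) :
    nr x = x.re ^ 2 - a * x.imI ^ 2 - b * x.imJ ^ 2 + a * b * x.imK ^ 2 := by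
  simp [nr]; ring

/-- The matrix of $x$ satisfies both the quadratic equation of $x$ and its own characteristic
equation. If it is not scalar, comparing the two identifies the traces, then the norms. Scalars are
checked directly. -/
theorem det_eq_nr {K : Type*} [Field K] {a b : K} (φ : ℍ[K, a, b] ≃ₐ[K] Matrix (Fin 2) (Fin 2) K)
    (x : ℍ[K, a, b]) : (φ x).det = nr x := by
  have h1 : x * x - (2 * x.re) • x + algebraMap K _ (nr x) = 0 := by
    rw [nr_eq]
    ext <;> simp [QuaternionAlgebra.algebraMap_eq] <;> ring
  have h2 := congrArg φ h1
  rw [map_add, map_sub, map_mul, map_smul, AlgEquiv.commutes, map_zero] at h2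
  set M := φ x with hM
  have h3 : M * M - M.trace • M + algebraMap K _ M.det = 0 := by
    have := Matrix.aeval_self_charpoly M
    rw [Matrix.charpoly_fin_two] at this
    simpa [pow_two, Algebra.smul_def] using this
  have h4 : (M.trace - 2 * x.re) • M = algebraMap K _ (M.det - nr x) := by
    rw [sub_smul, map_sub]
    rw [← sub_eq_zero, ← sub_self (0 : Matrix (Fin 2) (Fin 2) K)]
    nth_rewrite 1 [← h2]
    rw [← h3]
    abel
  by_cases hs : ∃ c : K, M = algebraMap K _ c
  · obtain ⟨c, hc⟩ := hs
    have hx : x = algebraMap K _ c := by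
      apply φ.injective
      rw [← hM, hc, AlgEquiv.commutes]
    rw [hc, hx, nr_eq]
    simp [QuaternionAlgebra.algebraMap_eq, Matrix.algebraMap_matrix_apply, Matrix.det_fin_two,
      pow_two]
  · have h5 : M.trace - 2 * x.re = 0 := by
      by_contra h
      refine hs ⟨(M.trace - 2 * x.re)⁻¹ * (M.det - nr x), ?_⟩
      rw [map_mul, ← h4, ← Algebra.smul_def, inv_smul_smul₀ h]
    rw [h5, zero_smul] at h4
    have := (algebraMap K (Matrix (Fin 2) (Fin 2) K)).injective (h4.symm.trans (map_zero _).symm)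
    exact sub_eq_zero.1 this

/-- This is the normalizer of $M_2$ of a valuation ring: $c$ is an entry of $z$ of largest value,
and $c^{-1}z$ turns out to be integral with integral inverse. -/
theorem exists_scalar_of_conj_integral {K Γ : Type*} [Field K] [LinearOrderedCommGroupWithZero Γ]
    (v : Valuation K Γ) {z w : Matrix (Fin 2) (Fin 2) K} (hzw : z * w = 1)
    (h : ∀ M : Matrix (Fin 2) (Fin 2) K, (∀ i j, v (M i j) ≤ 1) →
      ∀ i j, v ((z * M * w) i j) ≤ 1) :
    ∃ c : K, v z.det = v c ^ 2 ∧ c ≠ 0 ∧ (∀ i j, v (z i j) ≤ v c) ∧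
      ∀ i j, v (w i j) ≤ (v c)⁻¹ := by
  obtain ⟨⟨k, i⟩, hki⟩ := Finite.exists_max fun p : Fin 2 × Fin 2 => v (z p.1 p.2)
  have hc : z k i ≠ 0 := by
    intro h0
    have hz : z = 0 := by
      ext p q
      have := hki (p, q)
      simpa [h0] using this
    simp [hz] at hzw
  have hvc : v (z k i) ≠ 0 := by simpa using hc
  have hz : ∀ p q, v (z p q) ≤ v (z k i) := fun p q => hki (p, q)
  have hw : ∀ p q, v (w p q) ≤ (v (z k i))⁻¹ := by
    intro p q
    -- For the matrix unit $E_{ip}$, the $(k,q)$ entry of $zE_{ip}w$ is $z_{ki}w_{pq}$. Its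
    -- integrality bounds every entry of $w=z^{-1}$ by $v(c)^{-1}$.
    have h1 := h (Matrix.single i p 1) (fun r s => by
      rw [Matrix.single_apply]; split_ifs <;> simp) k q
    rw [Matrix.mul_assoc, Matrix.mul_apply] at h1
    have h2 : ∀ r, (Matrix.single i p (1 : K) * w) r q = if r = i then w p q else 0 := by
      intro r
      rw [Matrix.mul_apply]
      by_cases hr : r = i
      · subst hr
        simp [Matrix.single_apply]
      · simp [hr, Ne.symm hr]
    simp only [h2, mul_ite, mul_zero, Finset.sum_ite_eq', Finset.mem_univ, if_true, map_mul] at h1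
    rw [← mul_one (v (z k i))⁻¹]
    exact (le_inv_mul_iff₀ (zero_lt_iff.2 hvc)).2 h1
  refine ⟨z k i, ?_, hc, hz, hw⟩
  -- The bounds $v(\det z)\le v(c)^2$ and $v(\det w)\le v(c)^{-2}$ must be equalities, since the
  -- determinants multiply to $1$.
  have hdet : v z.det * v w.det = 1 := by
    rw [← map_mul, ← Matrix.det_mul, hzw, Matrix.det_one, map_one]
  have h1 : v z.det ≤ v (z k i) ^ 2 := by
    rw [Matrix.det_fin_two, pow_two]
    refine (v.map_sub _ _).trans (max_le ?_ ?_) <;> rw [map_mul] <;>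
      exact mul_le_mul' (hz _ _) (hz _ _)
  have h2 : v w.det ≤ (v (z k i))⁻¹ ^ 2 := by
    rw [Matrix.det_fin_two, pow_two]
    refine (v.map_sub _ _).trans (max_le ?_ ?_) <;> rw [map_mul] <;>
      exact mul_le_mul' (hw _ _) (hw _ _)
  refine le_antisymm h1 ?_
  have h3 : v z.det = (v w.det)⁻¹ := eq_inv_of_mul_eq_one_left hdet
  have h4 : v w.det ≠ 0 := right_ne_zero_of_mul_eq_one hdet
  rw [h3, le_inv_comm₀ (zero_lt_iff.2 (pow_ne_zero _ hvc)) (zero_lt_iff.2 h4), ← inv_pow]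
  exact h2

/-- Applying $L$ to a fixed nonzero vector of $K^2$ gives an $A$-lattice $\Lambda$, stable under $L$
because $L$ is closed under multiplication. Over a principal ideal ring $\Lambda$ is free, and in a
basis of $\Lambda$ the elements of $L$ have integral matrices. -/
theorem exists_algEquiv_integral {K : Type*} [Field K] (A : ValuationSubring K)
    [IsPrincipalIdealRing A] {D : Type*} [Ring D] [Algebra K D]
    (φ : D ≃ₐ[K] Matrix (Fin 2) (Fin 2) K) (L : Submodule A D) (hfg : L.FG)
    (hspan : Submodule.span K (L : Set D) = ⊤) (hmul : ∀ x ∈ L, ∀ y ∈ L, x * y ∈ L) :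
    ∃ ψ : D ≃ₐ[K] Matrix (Fin 2) (Fin 2) K, ∀ x ∈ L, ∀ i j, ψ x i j ∈ A := by
  let f : D →ₗ[K] (Fin 2 → K) :=
    (LinearMap.applyₗ (Pi.single 0 1 : Fin 2 → K)) ∘ₗ
      (Matrix.toLin' (R := K)).toLinearMap ∘ₗ φ.toLinearMap
  have hf : ∀ x, f x = φ x *ᵥ (Pi.single 0 1) := fun x => rfl
  have hsurj : Function.Surjective f := by
    intro w
    refine ⟨φ.symm (Matrix.of fun i _ => w i), ?_⟩
    rw [hf, AlgEquiv.apply_symm_apply]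
    ext i
    simp
  let Λ : Submodule A (Fin 2 → K) := L.map (f.restrictScalars A)
  have hΛ : Λ.IsLattice K := by
    refine ⟨hfg.map _, ?_⟩
    have : (Λ : Set (Fin 2 → K)) = f '' L := rfl
    rw [this, Submodule.span_image, hspan, Submodule.map_top, LinearMap.range_eq_top.2 hsurj]
  have hfree : Module.Free A Λ := Submodule.IsLattice.free K Λ
  have hfin : Module.finrank A Λ = 2 := by
    simpa using Submodule.IsLattice.finrank_of_pi (K := K) Λ
  let bΛ : Module.Basis (Fin 2) A Λ := Module.finBasisOfFinrankEq A Λ hfin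
  let B : Module.Basis (Fin 2) K (Fin 2 → K) := bΛ.extendOfIsLattice K
  have hB : ∀ i, B i = bΛ i := fun i => bΛ.extendOfIsLattice_apply K i
  have hrepr : ∀ w : Λ, ∀ i, B.repr w i ∈ A := by
    intro w i
    have : (w : Fin 2 → K) = ∑ j, ((bΛ.repr w j : A) : K) • B j := by
      conv_lhs => rw [← bΛ.sum_repr w]
      rw [Submodule.coe_sum]
      exact Finset.sum_congr rfl fun j _ => by rw [hB]; rfl
    rw [this, B.repr_sum_self]
    exact (bΛ.repr w i).2
  let ψ : D ≃ₐ[K] Matrix (Fin 2) (Fin 2) K :=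
    (φ.trans Matrix.toLinAlgEquiv').trans (LinearMap.toMatrixAlgEquiv B)
  refine ⟨ψ, fun x hx i j => ?_⟩
  have : ψ x i j = B.repr (φ x *ᵥ B j) i := LinearMap.toMatrixAlgEquiv_apply B _ i j
  rw [this, hB]
  obtain ⟨y, hy, hyj⟩ := (bΛ j).2
  have : φ x *ᵥ (bΛ j : Fin 2 → K) = f (x * y) := by
    rw [← hyj, hf, map_mul, ← Matrix.mulVec_mulVec]
    rfl
  rw [this]
  exact hrepr ⟨f (x * y), x * y, hmul x hx y hy, rfl⟩ i

end

section
variable {F : Type*} [Field F] [NumberField F] {a b : F}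

/-! ### Local components of a maximal order -/

theorem one_mem_hat (O : Subalgebra (𝓞 F) (Quat a b)) :
    1 ∈ hat (Subalgebra.toSubmodule O) := by
  rw [← map_one (toQuatOver (FinAdele F) a b)]
  exact toQuatOver_mem_hat (I := Subalgebra.toSubmodule O) O.one_mem

theorem smul_mul_assoc_quat (c : integralAdeles F) (x y : AdelicQuat a b) :
    (c • x) * y = c • (x * y) := smul_mul_assoc (c : FinAdele F) x y

theorem mul_smul_comm_quat (c : integralAdeles F) (x y : AdelicQuat a b) :
    x * (c • y) = c • (x * y) := mul_smul_comm (c : FinAdele F) x y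

theorem mul_mem_hat_of_mul_mem {I J K : Submodule (𝓞 F) (Quat a b)}
    (h : ∀ x ∈ I, ∀ y ∈ J, x * y ∈ K) {x y : AdelicQuat a b} (hx : x ∈ hat I) (hy : y ∈ hat J) :
    x * y ∈ hat K := by
  induction hx using Submodule.span_induction with
  | mem x hx =>
    obtain ⟨x, hx, rfl⟩ := hx
    induction hy using Submodule.span_induction with
    | mem y hy =>
      obtain ⟨y, hy, rfl⟩ := hy
      rw [← map_mul]
      exact toQuatOver_mem_hat (h x hx y hy)
    | zero => rw [mul_zero]; exact zero_mem _
    | add y z _ _ hy hz => rw [mul_add]; exact add_mem hy hz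
    | smul c y _ hy => rw [mul_smul_comm_quat]; exact Submodule.smul_mem _ _ hy
  | zero => rw [zero_mul]; exact zero_mem _
  | add x z _ _ hx hz => rw [add_mul]; exact add_mem hx hz
  | smul c x _ hx => rw [smul_mul_assoc_quat]; exact Submodule.smul_mem _ _ hx

theorem mul_mem_hat (O : Subalgebra (𝓞 F) (Quat a b)) {x y : AdelicQuat a b}
    (hx : x ∈ hat (Subalgebra.toSubmodule O)) (hy : y ∈ hat (Subalgebra.toSubmodule O)) :
    x * y ∈ hat (Subalgebra.toSubmodule O) :=
  mul_mem_hat_of_mul_mem (fun _ hx _ hy => O.mul_mem hx hy) hx hy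

theorem evalHom_intEmb (v : HeightOneSpectrum (𝓞 F)) (N : 𝓞 F) :
    evalHom v (intEmb N : FinAdele F) = algebraMap F (v.adicCompletion F) N := rfl

theorem algebraMap_ne_zero_of_ne_zero (v : HeightOneSpectrum (𝓞 F)) {N : 𝓞 F} (hN : N ≠ 0) :
    algebraMap F (v.adicCompletion F) N ≠ 0 := by
  simpa using hN

theorem proj_stdBasis (v : HeightOneSpectrum (𝓞 F)) (i : Fin 4) :
    proj v (stdBasis (algebraMap F (FinAdele F) a) (algebraMap F (FinAdele F) b) i) =
      stdBasis _ _ i := by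
  fin_cases i <;> ext1 <;> simp [stdBasis, proj]

theorem exists_integer_smul_isStdIntegral (v : HeightOneSpectrum (𝓞 F))
    (x : QuatOver (v.adicCompletion F) a b) :
    ∃ N : 𝓞 F, N ≠ 0 ∧ IsStdIntegral v (algebraMap F (v.adicCompletion F) N • x) := by
  obtain ⟨N, hN, h⟩ := exists_integer_smul_mem_stdHat (singleQuat v x)
  refine ⟨N, hN, ?_⟩
  have := mem_stdHat_iff.1 h v
  rwa [proj_smul, proj_singleQuat] at this

theorem fg_localPart (v : HeightOneSpectrum (𝓞 F))
    {M : Submodule (integralAdeles F) (AdelicQuat a b)} (hM : IsAdelicLattice M) :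
    (localPart v M).FG := by
  obtain ⟨N, hN, -, h2⟩ := hM
  have hN' := algebraMap_ne_zero_of_ne_zero v hN
  have hle : localPart v M ≤ Submodule.span (v.adicCompletionIntegers F)
      (Set.range fun i => (algebraMap F (v.adicCompletion F) N)⁻¹ •
        stdBasis (algebraMap F (v.adicCompletion F) a) (algebraMap F (v.adicCompletion F) b) i) := by
    rintro _ ⟨x, hx, rfl⟩
    have h := mem_stdHat_iff.1 (h2 x hx) v
    rw [proj_smul, evalHom_intEmb] at h
    rw [← inv_smul_smul₀ hN' (proj v x), ← sum_smul_stdBasis (algebraMap F _ (N : F) • proj v x),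
      smul_add, smul_add, smul_add]
    have key : ∀ {c : v.adicCompletion F} (hc : c ∈ v.adicCompletionIntegers F) (i : Fin 4),
        (algebraMap F (v.adicCompletion F) N)⁻¹ • c • stdBasis (algebraMap F (v.adicCompletion F) a)
          (algebraMap F (v.adicCompletion F) b) i ∈ Submodule.span (v.adicCompletionIntegers F)
      (Set.range fun i => (algebraMap F (v.adicCompletion F) N)⁻¹ •
        stdBasis (algebraMap F (v.adicCompletion F) a) (algebraMap F (v.adicCompletion F) b) i) := by
      intro c hc i
      rw [smul_comm]
      exact Submodule.smul_mem _ (⟨c, hc⟩ : v.adicCompletionIntegers F)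
        (Submodule.subset_span ⟨i, rfl⟩)
    exact add_mem (add_mem (add_mem (key h.1 0) (key h.2.1 1)) (key h.2.2.1 2)) (key h.2.2.2 3)
  have : IsNoetherian (v.adicCompletionIntegers F) (Submodule.span (v.adicCompletionIntegers F)
      (Set.range fun i => (algebraMap F (v.adicCompletion F) N)⁻¹ •
        stdBasis (algebraMap F (v.adicCompletion F) a) (algebraMap F (v.adicCompletion F) b) i)) :=
    isNoetherian_span_of_finite _ (Set.finite_range _)
  exact Submodule.FG.of_le_of_isNoetherian hle

theorem span_localPart (v : HeightOneSpectrum (𝓞 F))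
    {M : Submodule (integralAdeles F) (AdelicQuat a b)} (hM : IsAdelicLattice M) :
    Submodule.span (v.adicCompletion F)
      (localPart v M : Set (QuatOver (v.adicCompletion F) a b)) = ⊤ := by
  obtain ⟨N, hN, h1, -⟩ := hM
  have hN' := algebraMap_ne_zero_of_ne_zero v hN
  rw [eq_top_iff]
  intro x _
  have hb : ∀ i, stdBasis (algebraMap F (v.adicCompletion F) a)
      (algebraMap F (v.adicCompletion F) b) i ∈ Submodule.span (v.adicCompletion F)
        (localPart v M : Set (QuatOver (v.adicCompletion F) a b)) := by
    intro i
    have h := proj_mem_localPart (v := v) (h1 _ (stdBasis_mem_stdHat i))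
    rw [proj_smul, proj_stdBasis, evalHom_intEmb] at h
    have h3 := Submodule.smul_mem _ (algebraMap F (v.adicCompletion F) N)⁻¹
      (Submodule.subset_span (R := v.adicCompletion F) h)
    rwa [inv_smul_smul₀ hN'] at h3
  rw [← sum_smul_stdBasis x]
  exact add_mem (add_mem (add_mem (Submodule.smul_mem _ _ (hb 0)) (Submodule.smul_mem _ _ (hb 1)))
    (Submodule.smul_mem _ _ (hb 2))) (Submodule.smul_mem _ _ (hb 3))

theorem exists_algEquiv_localPart_hat {O : Subalgebra (𝓞 F) (Quat a b)} (hO : IsOrder O)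
    (v : HeightOneSpectrum (𝓞 F)) (hv : IsSplitOver (v.adicCompletion F) a b) :
    ∃ ψ : QuatOver (v.adicCompletion F) a b ≃ₐ[v.adicCompletion F]
        Matrix (Fin 2) (Fin 2) (v.adicCompletion F),
      ∀ x ∈ localPart v (hat (Subalgebra.toSubmodule O)), ∀ i j,
        ψ x i j ∈ v.adicCompletionIntegers F := by
  obtain ⟨φ⟩ := hv
  have hlat := isAdelicLattice_hat hO
  refine exists_algEquiv_integral (v.adicCompletionIntegers F) φ
    (localPart v (hat (Subalgebra.toSubmodule O))) (fg_localPart v hlat) (span_localPart v hlat) ?_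
  rintro _ ⟨x, hx, rfl⟩ _ ⟨y, hy, rfl⟩
  exact ⟨x * y, mul_mem_hat O hx hy, map_mul _ _ _⟩

/-- The submodule that is integral at `v` with respect to `ψ`, and agrees with the given one
away from `v`. -/
def replaceAt (v : HeightOneSpectrum (𝓞 F))
    (ψ : QuatOver (v.adicCompletion F) a b ≃ₐ[v.adicCompletion F]
        Matrix (Fin 2) (Fin 2) (v.adicCompletion F))
    (M : Submodule (integralAdeles F) (AdelicQuat a b)) :
    Submodule (integralAdeles F) (AdelicQuat a b) where
  carrier := {x | indicatorAdele {v}ᶜ • x ∈ M ∧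
    ∀ i j, ψ (proj v x) i j ∈ v.adicCompletionIntegers F}
  zero_mem' := ⟨by rw [smul_zero]; exact zero_mem _, fun i j => by
    rw [map_zero, map_zero]; exact zero_mem _⟩
  add_mem' hx hy := ⟨by rw [smul_add]; exact add_mem hx.1 hy.1, fun i j => by
    rw [map_add, map_add]; exact add_mem (hx.2 i j) (hy.2 i j)⟩
  smul_mem' c x hx := ⟨by rw [smul_comm]; exact M.smul_mem _ hx.1, fun i j => by
    rw [proj_smul, map_smul]; exact mul_mem (c.2 v) (hx.2 i j)⟩

theorem isStdIntegral_add {v : HeightOneSpectrum (𝓞 F)} {x y : QuatOver (v.adicCompletion F) a b}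
    (hx : IsStdIntegral v x) (hy : IsStdIntegral v y) : IsStdIntegral v (x + y) :=
  ⟨add_mem hx.1 hy.1, add_mem hx.2.1 hy.2.1, add_mem hx.2.2.1 hy.2.2.1, add_mem hx.2.2.2 hy.2.2.2⟩

theorem isStdIntegral_smul {v : HeightOneSpectrum (𝓞 F)} {c : v.adicCompletion F}
    (hc : c ∈ v.adicCompletionIntegers F) {x : QuatOver (v.adicCompletion F) a b}
    (hx : IsStdIntegral v x) : IsStdIntegral v (c • x) :=
  ⟨mul_mem hc hx.1, mul_mem hc hx.2.1, mul_mem hc hx.2.2.1, mul_mem hc hx.2.2.2⟩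

/-- It suffices to clear the denominators of the preimages of the four matrix units. -/
theorem exists_integer_smul_isStdIntegral_of_integral (v : HeightOneSpectrum (𝓞 F))
    (ψ : QuatOver (v.adicCompletion F) a b ≃ₐ[v.adicCompletion F]
        Matrix (Fin 2) (Fin 2) (v.adicCompletion F)) :
    ∃ N : 𝓞 F, N ≠ 0 ∧ ∀ x, (∀ i j, ψ x i j ∈ v.adicCompletionIntegers F) →
      IsStdIntegral v (algebraMap F (v.adicCompletion F) N • x) := by
  choose f hf0 hf using fun p : Fin 2 × Fin 2 =>
    exists_integer_smul_isStdIntegral v (ψ.symm (Matrix.single p.1 p.2 1))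
  refine ⟨∏ p, f p, Finset.prod_ne_zero_iff.2 fun p _ => hf0 p, fun x hx => ?_⟩
  have hint : ∀ r : 𝓞 F, algebraMap F (v.adicCompletion F) r ∈ v.adicCompletionIntegers F :=
    fun r => (intEmb r).2 v
  have hx' : x = ∑ p : Fin 2 × Fin 2, ψ x p.1 p.2 • ψ.symm (Matrix.single p.1 p.2 1) := by
    apply ψ.injective
    rw [map_sum]
    simp_rw [map_smul, AlgEquiv.apply_symm_apply]
    conv_lhs => rw [Matrix.matrix_eq_sum_single (ψ x)]
    rw [Fintype.sum_prod_type]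
    simp [Matrix.smul_single]
  rw [hx', Finset.smul_sum]
  refine Finset.sum_induction _ (IsStdIntegral v) (fun _ _ => isStdIntegral_add)
    ⟨zero_mem _, zero_mem _, zero_mem _, zero_mem _⟩ fun p _ => ?_
  rw [smul_comm]
  refine isStdIntegral_smul (hx _ _) ?_
  rw [← Finset.prod_erase_mul _ _ (Finset.mem_univ p)]
  change IsStdIntegral v (algebraMap F (v.adicCompletion F) (algebraMap (𝓞 F) F _) • _)
  rw [map_mul, map_mul, mul_smul]
  exact isStdIntegral_smul (hint _) (hf p)

theorem isAdelicLattice_replaceAt (v : HeightOneSpectrum (𝓞 F))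
    (ψ : QuatOver (v.adicCompletion F) a b ≃ₐ[v.adicCompletion F]
        Matrix (Fin 2) (Fin 2) (v.adicCompletion F))
    {M : Submodule (integralAdeles F) (AdelicQuat a b)} (hM : IsAdelicLattice M)
    (h : ∀ x ∈ localPart v M, ∀ i j, ψ x i j ∈ v.adicCompletionIntegers F) :
    M ≤ replaceAt v ψ M ∧ IsAdelicLattice (replaceAt v ψ M) := by
  have hle : M ≤ replaceAt v ψ M := fun x hx => ⟨M.smul_mem _ hx, h _ (proj_mem_localPart hx)⟩
  refine ⟨hle, ?_⟩
  obtain ⟨N, hN, h1, h2⟩ := hM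
  obtain ⟨N', hN', hψ⟩ := exists_integer_smul_isStdIntegral_of_integral v ψ
  have hint : ∀ (w : HeightOneSpectrum (𝓞 F)) (r : 𝓞 F),
      algebraMap F (w.adicCompletion F) r ∈ w.adicCompletionIntegers F :=
    fun w r => (intEmb r).2 w
  refine ⟨N * N', mul_ne_zero hN hN', fun x hx => ?_, fun x hx => ?_⟩
  · rw [mul_comm, map_mul, mul_smul]
    exact hle (M.smul_mem _ (h1 x hx))
  · rw [mem_stdHat_iff]
    intro w
    rw [map_mul, proj_smul, Subring.coe_mul, map_mul, evalHom_intEmb, evalHom_intEmb]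
    by_cases hw : w = v
    · subst hw
      rw [mul_smul]
      exact isStdIntegral_smul (hint _ _) (hψ _ hx.2)
    · rw [mul_comm, mul_smul]
      refine isStdIntegral_smul (hint _ _) ?_
      have := mem_stdHat_iff.1 (h2 _ hx.1) w
      rw [proj_smul, proj_smul, evalHom_indicatorAdele_of_mem (S := {v}ᶜ) hw, one_smul,
        evalHom_intEmb] at this
      exact this

/-- Here maximality enters. Enlarging $\widehat{\mathbb O}$ at $v$ to the full matrix order keeps it
a multiplicatively closed adelic lattice. Its global part is an order containing $\mathbb O$, hence
equal to it, so nothing was enlarged. -/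
theorem mem_localPart_hat_of_integral {O : Subalgebra (𝓞 F) (Quat a b)} (hO : IsMaximalOrder O)
    (v : HeightOneSpectrum (𝓞 F))
    (ψ : QuatOver (v.adicCompletion F) a b ≃ₐ[v.adicCompletion F]
        Matrix (Fin 2) (Fin 2) (v.adicCompletion F))
    (h : ∀ x ∈ localPart v (hat (Subalgebra.toSubmodule O)), ∀ i j,
      ψ x i j ∈ v.adicCompletionIntegers F)
    {x : QuatOver (v.adicCompletion F) a b} (hx : ∀ i j, ψ x i j ∈ v.adicCompletionIntegers F) :
    x ∈ localPart v (hat (Subalgebra.toSubmodule O)) := by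
  obtain ⟨hle, hlat⟩ := isAdelicLattice_replaceAt v ψ (isAdelicLattice_hat hO.prop) h
  set M := replaceAt v ψ (hat (Subalgebra.toSubmodule O)) with hMdef
  have hmul : ∀ x ∈ M, ∀ y ∈ M, x * y ∈ M := by
    intro x hx y hy
    refine ⟨?_, fun i j => ?_⟩
    · have : indicatorAdele {v}ᶜ • (x * y) =
          (indicatorAdele {v}ᶜ • x) * (indicatorAdele {v}ᶜ • y) := by
        refine adelicQuat_ext fun w => ?_
        rw [map_mul, proj_smul, proj_smul, proj_smul, map_mul]
        by_cases hw : w = v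
        · rw [evalHom_indicatorAdele_of_notMem (S := {v}ᶜ) (by simpa using hw)]
          simp
        · rw [evalHom_indicatorAdele_of_mem (S := {v}ᶜ) hw]
          simp
      rw [this]
      exact mul_mem_hat O hx.1 hy.1
    · rw [map_mul, map_mul, Matrix.mul_apply]
      exact sum_mem fun k _ => mul_mem (hx.2 i k) (hy.2 k j)
  let O' : Subalgebra (𝓞 F) (Quat a b) :=
    (globalPart M).toSubalgebra
      (by
        change toQuatOver (FinAdele F) a b 1 ∈ M
        rw [map_one]
        exact hle (one_mem_hat O))
      (fun x y hx hy => by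
        change toQuatOver (FinAdele F) a b (x * y) ∈ M
        rw [map_mul]
        exact hmul _ hx _ hy)
  have hO' : IsOrder O' := isLattice_globalPart hlat
  have hOO' : O ≤ O' := fun x hx => hle (toQuatOver_mem_hat (I := Subalgebra.toSubmodule O) hx)
  have hO'O := hO.le_of_ge hO' hOO'
  have hM : M ≤ hat (Subalgebra.toSubmodule O) := by
    rw [← hat_globalPart hlat]
    refine Submodule.span_mono (Set.image_mono fun x hx => ?_)
    exact hO'O hx
  have hxM : singleQuat v x ∈ M := by
    refine ⟨?_, fun i j => ?_⟩
    · convert (hat (Subalgebra.toSubmodule O)).zero_mem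
      refine adelicQuat_ext fun w => ?_
      rw [proj_smul, map_zero]
      by_cases hw : w = v
      · rw [evalHom_indicatorAdele_of_notMem (S := {v}ᶜ) (by simpa using hw), zero_smul]
      · rw [proj_singleQuat_of_ne hw, smul_zero]
    · rw [proj_singleQuat]
      exact hx i j
  exact ⟨_, hM hxM, proj_singleQuat v x⟩

theorem evalHom_nr (v : HeightOneSpectrum (𝓞 F)) (x : AdelicQuat a b) :
    evalHom v (nr x) = nr (proj v x) := by
  rw [nr_eq, nr_eq]
  simp [proj]

/-- The normalizer of the completion of a maximal order in an algebra that is split at all finite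
places is, up to the centre, its unit group. -/
theorem smul_mem_hat_of_normalizes {O : Subalgebra (𝓞 F) (Quat a b)} (hO : IsMaximalOrder O)
    (hsplit : ∀ v : HeightOneSpectrum (𝓞 F), IsSplitOver (v.adicCompletion F) a b)
    (z : (AdelicQuat a b)ˣ)
    (hz : ∀ x ∈ hat (Subalgebra.toSubmodule O), (z : AdelicQuat a b) * x * (z⁻¹ : (AdelicQuat a b)ˣ) ∈
      hat (Subalgebra.toSubmodule O)) :
    (∀ v : HeightOneSpectrum (𝓞 F), ∃ c : v.adicCompletion F,
      Valued.v (evalHom v (nr (z : AdelicQuat a b))) = Valued.v c ^ 2) ∧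
    ∀ γ : F, γ ≠ 0 →
      (∀ v : HeightOneSpectrum (𝓞 F), Valued.v (evalHom v (nr (z : AdelicQuat a b))) =
        v.valuation F γ ^ 2) →
      algebraMap F (FinAdele F) γ⁻¹ • (z : AdelicQuat a b) ∈ hat (Subalgebra.toSubmodule O) ∧
      algebraMap F (FinAdele F) γ • ((z⁻¹ : (AdelicQuat a b)ˣ) : AdelicQuat a b) ∈
        hat (Subalgebra.toSubmodule O) := by
  choose ψ hψ using fun v => exists_algEquiv_localPart_hat hO.prop v (hsplit v)
  have key : ∀ v : HeightOneSpectrum (𝓞 F), ∃ c : v.adicCompletion F,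
      Valued.v (evalHom v (nr (z : AdelicQuat a b))) = Valued.v c ^ 2 ∧ c ≠ 0 ∧
      (∀ i j, Valued.v (ψ v (proj v z) i j) ≤ Valued.v c) ∧
      ∀ i j, Valued.v (ψ v (proj v ((z⁻¹ : (AdelicQuat a b)ˣ) : AdelicQuat a b)) i j) ≤
        (Valued.v c)⁻¹ := by
    intro v
    rw [evalHom_nr, ← det_eq_nr (ψ v)]
    refine exists_scalar_of_conj_integral Valued.v ?_ fun M hM => ?_
    · rw [← map_mul, ← map_mul, Units.mul_inv, map_one, map_one]
    -- Every integral matrix comes from $\widehat{\mathbb O}$, so the hypothesis on $z$ becomes one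
    -- on all of $M_2(O_{F_v})$.
    · obtain ⟨y, hy, hyM⟩ := mem_localPart_hat_of_integral hO v (ψ v) (hψ v) (x := (ψ v).symm M)
        (by simpa using! hM)
      rw [AlgEquiv.eq_symm_apply] at hyM
      rw [← hyM, ← map_mul, ← map_mul, ← map_mul, ← map_mul]
      exact hψ v _ (proj_mem_localPart (hz y hy))
  refine ⟨fun v => (key v).imp fun c hc => hc.1, fun γ hγ h => ?_⟩
  have hval : ∀ v : HeightOneSpectrum (𝓞 F), v.valuation F γ ≠ 0 := fun v => by simpa using hγ
  have hlat := isAdelicLattice_hat hO.prop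
  constructor
  · refine mem_of_forall_proj_mem hlat fun v =>
      mem_localPart_hat_of_integral hO v (ψ v) (hψ v) fun i j => ?_
    obtain ⟨c, hc, hc0, hcz, -⟩ := key v
    rw [h v] at hc
    have hc' : v.valuation F γ = Valued.v c := (pow_left_inj₀ zero_le zero_le two_ne_zero).1 hc
    rw [proj_smul_field, map_smul, evalHom_algebraMap, Matrix.smul_apply, smul_eq_mul,
      HeightOneSpectrum.mem_adicCompletionIntegers, map_mul, valued_algebraMap, map_inv₀,
      inv_mul_le_iff₀ (zero_lt_iff.2 (hval v)), mul_one, hc']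
    exact hcz i j
  · refine mem_of_forall_proj_mem hlat fun v =>
      mem_localPart_hat_of_integral hO v (ψ v) (hψ v) fun i j => ?_
    obtain ⟨c, hc, hc0, -, hcz⟩ := key v
    rw [h v] at hc
    have hc' : v.valuation F γ = Valued.v c := (pow_left_inj₀ zero_le zero_le two_ne_zero).1 hc
    rw [proj_smul_field, map_smul, evalHom_algebraMap, Matrix.smul_apply, smul_eq_mul,
      HeightOneSpectrum.mem_adicCompletionIntegers, map_mul, valued_algebraMap, hc',
      ← le_inv_mul_iff₀ (zero_lt_iff.2 (by simpa using hc0)), mul_one]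
    exact hcz i j

end

section

/-! ### The equation `x² - p y² = ± 2` -/

theorem exists_sq_of_mul_eq_mul_sq {p : ℕ} (hp : p.Prime) {m n y : ℕ} (h : m * n = p * y ^ 2)
    (hmn : m.Coprime n) :
    (∃ k l, m = p * k ^ 2 ∧ n = l ^ 2) ∨ ∃ k l, m = k ^ 2 ∧ n = p * l ^ 2 := by
  have key : ∀ {m n : ℕ}, m * n = p * y ^ 2 → m.Coprime n → p ∣ m →
      ∃ k l, m = p * k ^ 2 ∧ n = l ^ 2 := by
    rintro m n h hmn ⟨k, rfl⟩
    rw [mul_assoc] at h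
    have h := Nat.eq_of_mul_eq_mul_left hp.pos h
    have hkn : k.Coprime n := Nat.Coprime.coprime_mul_left hmn
    obtain ⟨c, hc⟩ := exists_associated_pow_of_mul_eq_pow (α := ℕ)
      (by rw [gcd_eq_nat_gcd, hkn]; exact isUnit_one) h
    obtain ⟨d, hd⟩ := exists_associated_pow_of_mul_eq_pow (α := ℕ)
      (by rw [gcd_eq_nat_gcd, hkn.symm]; exact isUnit_one) ((mul_comm n k).trans h)
    rw [associated_iff_eq] at hc hd
    exact ⟨c, d, by rw [hc], hd.symm⟩
  rcases hp.dvd_mul.1 (Dvd.intro _ h.symm) with h1 | h1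
  · exact Or.inl (key h hmn h1)
  · obtain ⟨k, l, h2, h3⟩ := key ((mul_comm n m).trans h) hmn.symm h1
    exact Or.inr ⟨l, k, h3, h2⟩

/-- Legendre's argument: factor $(x-1)(x+1)=py^2$ for the positive solution of Pell's equation with
least $y$. If $x$ is even the factors are coprime, so one is a square and the other $p$ times a
square, and they differ by $2$. An odd $x$ is impossible. -/
theorem exists_sq_sub_mul_sq_eq_two {p : ℕ} (hp : p.Prime) (hp4 : p % 4 = 3) :
    ∃ x y : ℤ, x ^ 2 - p * y ^ 2 = 2 ∨ x ^ 2 - p * y ^ 2 = -2 := by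
  classical
  have hex : ∃ y : ℕ, 0 < y ∧ ∃ x : ℕ, x ^ 2 = 1 + p * y ^ 2 := by
    obtain ⟨x, y, hxy, hy⟩ := Pell.exists_of_not_isSquare (d := (p : ℤ))
      (by exact_mod_cast hp.pos) (by
        rw [Int.isSquare_natCast_iff]; exact Irreducible.not_isSquare hp)
    refine ⟨y.natAbs, Int.natAbs_pos.2 hy, x.natAbs, ?_⟩
    zify
    rw [sq_abs, sq_abs]
    linarith
  obtain ⟨hy, x, hx⟩ := Nat.find_spec hex
  have hmin := fun m => Nat.find_min hex (m := m)
  set y := Nat.find hex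
  have hx1 : 1 < x := by
    by_contra h
    have : p * y ^ 2 > 0 := by have := hp.pos; positivity
    have : x ^ 2 ≤ 1 := by
      have : x ≤ 1 := not_lt.1 h
      nlinarith
    omega
  rcases Nat.even_or_odd' x with ⟨h, rfl | rfl⟩
  · obtain ⟨h, rfl⟩ : ∃ k, h = k + 1 := ⟨h - 1, by omega⟩
    have e : (2 * h + 1) * (2 * h + 3) = p * y ^ 2 := by nlinarith
    have hc : (2 * h + 1).Coprime (2 * h + 3) := by
      rw [show 2 * h + 3 = 2 + (2 * h + 1) by ring, Nat.coprime_add_self_right]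
      simp
    rcases exists_sq_of_mul_eq_mul_sq hp e hc with ⟨k, l, h1, h2⟩ | ⟨k, l, h1, h2⟩
    · refine ⟨l, k, Or.inl ?_⟩
      zify at h1 h2
      linarith
    · refine ⟨k, l, Or.inr ?_⟩
      zify at h1 h2
      linarith
  · exfalso
    have hye : Even y := by
      by_contra hyo
      obtain ⟨r, hr⟩ := Nat.not_even_iff_odd.1 hyo
      obtain ⟨q, hq⟩ : ∃ q, p = 4 * q + 3 := ⟨p / 4, by omega⟩
      have : (4 * h ^ 2 + 4 * h) = (4 * q + 3) * (4 * r ^ 2 + 4 * r + 1) := by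
        rw [hr, hq] at hx; nlinarith
      have h2 : 4 * (h ^ 2 + h) = 4 * (4 * q * (r ^ 2 + r) + q + 3 * (r ^ 2 + r)) + 3 := by
        linarith
      omega
    obtain ⟨r, hr⟩ := hye
    have e : h * (h + 1) = p * r ^ 2 := by
      rw [hr] at hx; nlinarith
    have hh : 0 < h := by omega
    -- The coprime factors are now $(x-1)/2$ and $(x+1)/2$. The first case gives $l^2-pk^2=1$ with
    -- $0<k<y$, against minimality. The second gives $k^2+1=pl^2$, impossible modulo $4$.
    rcases exists_sq_of_mul_eq_mul_sq hp e (by simp) with ⟨k, l, h1, h2⟩ | ⟨k, l, h1, h2⟩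
    · have hk : 0 < k := by
        rcases Nat.eq_zero_or_pos k with rfl | hk
        · simp at h1; omega
        · exact hk
      refine hmin k ?_ ⟨hk, l, by omega⟩
      have h3 : k ^ 2 ≤ r ^ 2 := by
        have h4 : p * (k ^ 2 * (h + 1)) = p * r ^ 2 := by rw [← e, h1]; ring
        have h5 := Nat.eq_of_mul_eq_mul_left hp.pos h4
        nlinarith [Nat.zero_le (k ^ 2 * h)]
      have h4 := (Nat.pow_le_pow_iff_left two_ne_zero).1 h3
      omega
    · have h3 : k ^ 2 + 1 = p * l ^ 2 := by omega
      have hsq : ∀ n : ℕ, n ^ 2 % 4 = 0 ∨ n ^ 2 % 4 = 1 := by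
        intro n
        rcases Nat.even_or_odd' n with ⟨c, rfl | rfl⟩
        · left; ring_nf; omega
        · right; ring_nf; omega
      obtain ⟨q, hq⟩ : ∃ q, p = 4 * q + 3 := ⟨p / 4, by omega⟩
      have h4 : k ^ 2 + 1 = 4 * (q * l ^ 2) + 3 * l ^ 2 := by rw [h3, hq]; ring
      have := hsq k
      have := hsq l
      omega

/-! ### Square ideals -/

/-- All exponents in the factorization of $(r)$ are even. Halving them gives $J$. -/
theorem exists_sq_eq_span_of_valuation_sq {R K : Type*} [CommRing R] [IsDedekindDomain R]
    [Field K] [Algebra R K] [IsFractionRing R K] {r : R} (hr : r ≠ 0)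
    (h : ∀ v : HeightOneSpectrum R, ∃ g : ℤᵐ⁰, v.valuation K (algebraMap R K r) = g ^ 2) :
    ∃ J : Ideal R, J ^ 2 = Ideal.span {r} := by
  have hI : Ideal.span {r} ≠ 0 := by simpa [Submodule.zero_eq_bot] using hr
  have hev : ∀ v : HeightOneSpectrum R, ∃ k : ℕ,
      (Associates.mk v.asIdeal).count (Associates.mk (Ideal.span {r})).factors = 2 * k := by
    intro v
    obtain ⟨g, hg⟩ := h v
    rw [v.valuation_of_algebraMap, v.intValuation_if_neg hr] at hg
    have hg0 : g ≠ 0 := by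
      rintro rfl
      simp at hg
    have := congrArg log hg
    rw [log_exp, log_pow] at this
    refine ⟨(-log g).toNat, ?_⟩
    simp only [nsmul_eq_mul, Nat.cast_ofNat] at this
    omega
  choose k hk using hev
  refine ⟨∏ᶠ v : HeightOneSpectrum R, v.asIdeal ^ k v, ?_⟩
  rw [finprod_pow, ← Ideal.finprod_heightOneSpectrum_factorization hI]
  · refine finprod_congr fun v => ?_
    rw [HeightOneSpectrum.maxPowDividing, hk, mul_comm, pow_mul]
  · refine (Ideal.hasFiniteMulSupport hI).subset fun v hv => ?_
    rw [Function.mem_mulSupport] at hv ⊢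
    intro h1
    apply hv
    rw [HeightOneSpectrum.maxPowDividing, hk, mul_comm, pow_mul] at h1
    rw [Ideal.one_eq_top] at h1 ⊢
    exact top_unique (h1 ▸ Ideal.pow_le_self two_ne_zero)

end

section

/-! ### The field `ℚ(√p)` -/

theorem eq_zero_of_add_mul_eq_zero {p : ℕ} (hp : p.Prime) {K : Type*} [Field K] [CharZero K]
    {r : K} (hr : r ^ 2 = p) {u w : ℚ} (h : (u : K) + w * r = 0) : u = 0 ∧ w = 0 := by
  have h1 : (u : K) ^ 2 = w ^ 2 * p := by rw [← hr]; linear_combination (u - w * r) * h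
  have h2 : u ^ 2 = w ^ 2 * p := by exact_mod_cast h1
  have hw : w = 0 := by
    by_contra hw
    have h3 : IsSquare (p : ℚ) := ⟨u / w, by field_simp; linarith⟩
    rw [Rat.isSquare_natCast_iff] at h3
    exact Irreducible.not_isSquare hp h3
  subst hw
  exact ⟨by simpa using h, rfl⟩

theorem eq_and_eq_of_add_mul_eq {p : ℕ} (hp : p.Prime) {K : Type*} [Field K] [CharZero K]
    {r : K} (hr : r ^ 2 = p) {u w u' w' : ℚ} (h : (u : K) + w * r = u' + w' * r) :
    u = u' ∧ w = w' := by
  have := eq_zero_of_add_mul_eq_zero hp hr (u := u - u') (w := w - w')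
    (by push_cast; linear_combination h)
  exact ⟨sub_eq_zero.1 this.1, sub_eq_zero.1 this.2⟩

variable {p : ℕ} {F : Type*} [Field F] [NumberField F] {s : F}

theorem exists_eq_add_mul (hs : s ^ 2 = (p : F)) (hF : IntermediateField.adjoin ℚ {s} = ⊤) (x : F) :
    ∃ u w : ℚ, x = u + w * s := by
  have hx : x ∈ Algebra.adjoin ℚ {s} := by
    rw [← IntermediateField.adjoin_simple_toSubalgebra_of_isAlgebraic
      (Algebra.IsAlgebraic.isAlgebraic s), hF]
    trivial
  induction hx using Algebra.adjoin_induction with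
  | mem x hx => exact ⟨0, 1, by rw [Set.mem_singleton_iff.1 hx]; simp⟩
  | algebraMap r => exact ⟨r, 0, by simp⟩
  | add x y _ _ hx hy =>
    obtain ⟨u, w, rfl⟩ := hx
    obtain ⟨u', w', rfl⟩ := hy
    exact ⟨u + u', w + w', by push_cast; ring⟩
  | mul x y _ _ hx hy =>
    obtain ⟨u, w, rfl⟩ := hx
    obtain ⟨u', w', rfl⟩ := hy
    refine ⟨u * u' + p * w * w', u * w' + w * u', ?_⟩
    push_cast
    linear_combination (w * w' : F) * hs

/-- Coordinates with respect to $1,s$ are unique, so $s\mapsto r$ extends. This supplies both the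
conjugation of $F$ and the two real embeddings. -/
theorem exists_ringHom (hp : p.Prime) (hs : s ^ 2 = (p : F))
    (hF : IntermediateField.adjoin ℚ {s} = ⊤) {K : Type*} [Field K] [CharZero K] {r : K}
    (hr : r ^ 2 = p) : ∃ f : F →+* K, f s = r := by
  choose u w huw using exists_eq_add_mul hs hF
  have huniq : ∀ x (a b : ℚ), x = a + b * s → u x = a ∧ w x = b := fun x a b h =>
    eq_and_eq_of_add_mul_eq hp hs ((huw x).symm.trans h)
  refine ⟨{ toFun := fun x => u x + w x * r, map_one' := ?_, map_mul' := ?_, map_zero' := ?_,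
            map_add' := ?_ }, ?_⟩
  · obtain ⟨h1, h2⟩ := huniq 1 1 0 (by simp)
    simp [h1, h2]
  · intro x y
    obtain ⟨h1, h2⟩ := huniq (x * y) (u x * u y + p * w x * w y) (u x * w y + w x * u y) (by
      conv_lhs => rw [huw x, huw y]
      push_cast
      linear_combination (w x * w y : F) * hs)
    rw [h1, h2]
    push_cast
    linear_combination (-w x * w y : K) * hr
  · obtain ⟨h1, h2⟩ := huniq 0 0 0 (by simp)
    simp [h1, h2]
  · intro x y
    obtain ⟨h1, h2⟩ := huniq (x + y) (u x + u y) (w x + w y) (by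
      conv_lhs => rw [huw x, huw y]
      push_cast
      ring)
    rw [h1, h2]
    push_cast
    ring
  · obtain ⟨h1, h2⟩ := huniq s 0 1 (by simp)
    simp [h1, h2]

theorem norm_add_mul (hp : p.Prime) (hs : s ^ 2 = (p : F))
    (hF : IntermediateField.adjoin ℚ {s} = ⊤) (u w : ℚ) :
    Algebra.norm ℚ (u + w * s : F) = u ^ 2 - p * w ^ 2 := by
  have hli : LinearIndependent ℚ ![1, s] := by
    rw [LinearIndependent.pair_iff]
    intro a b h
    refine eq_zero_of_add_mul_eq_zero hp hs ?_
    simpa [Algebra.smul_def] using h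
  have hsp : ⊤ ≤ Submodule.span ℚ (Set.range ![1, s]) := by
    intro x _
    obtain ⟨u, w, rfl⟩ := exists_eq_add_mul hs hF x
    rw [Matrix.range_cons_cons_empty, Submodule.mem_span_pair]
    exact ⟨u, w, by simp [Algebra.smul_def]⟩
  let B := Module.Basis.mk hli hsp
  have hB0 : B 0 = 1 := by simp [B]
  have hB1 : B 1 = s := by simp [B]
  have h0 : (u + w * s : F) * B 0 = u • B 0 + w • B 1 := by
    rw [hB0, hB1]; simp [Algebra.smul_def]
  have h1 : (u + w * s : F) * B 1 = (p * w) • B 0 + u • B 1 := by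
    rw [hB0, hB1]; simp [Algebra.smul_def]; linear_combination (w : F) * hs
  rw [Algebra.norm_eq_matrix_det B, Matrix.det_fin_two]
  simp only [Algebra.leftMulMatrix_eq_repr_mul, h0, h1, map_add, map_smul, Module.Basis.repr_self]
  simp
  ring

/-! ### Integers of $\mathbb Q(\sqrt p)$ in half-integral coordinates, and unramified primes. -/

theorem exists_int_of_isIntegral {q : ℚ} (h : IsIntegral ℤ (q : F)) : ∃ n : ℤ, q = n := by
  have h2 : IsIntegral ℤ (algebraMap ℚ F q) := by simpa using h
  rw [isIntegral_algebraMap_iff (algebraMap ℚ F).injective, IsIntegrallyClosed.isIntegral_iff] at h2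
  obtain ⟨n, hn⟩ := h2
  exact ⟨n, by simp [← hn]⟩

/-- Here $T$ and $n$ are the trace and norm of $c$. This form treats all residues of $p$ modulo $4$
uniformly, without determining an integral basis. -/
theorem exists_int_coords (hp : p.Prime) (hs : s ^ 2 = (p : F))
    (hF : IntermediateField.adjoin ℚ {s} = ⊤) (c : 𝓞 F) :
    ∃ T n Y : ℤ, (2 * c : F) = T + Y * s ∧ T ^ 2 - p * Y ^ 2 = 4 * n := by
  obtain ⟨σ, hσ⟩ := exists_ringHom hp hs hF (K := F) (r := -s) (by rw [neg_sq, hs])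
  obtain ⟨u, w, huw⟩ := exists_eq_add_mul hs hF (c : F)
  have hσc : σ c = u - w * s := by
    rw [huw, map_add, map_mul, hσ, map_ratCast, map_ratCast]; ring
  have hc : IsIntegral ℤ (c : F) := c.2
  have hσi : IsIntegral ℤ (σ c) := hc.map (σ.toIntAlgHom)
  obtain ⟨T, hT⟩ := exists_int_of_isIntegral (F := F) (q := 2 * u) (by
    have : ((2 * u : ℚ) : F) = c + σ c := by
      rw [hσc, huw]; push_cast; ring
    rw [this]
    exact hc.add hσi)
  obtain ⟨n, hn⟩ := exists_int_of_isIntegral (F := F) (q := u ^ 2 - p * w ^ 2) (by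
    have : ((u ^ 2 - p * w ^ 2 : ℚ) : F) = c * σ c := by
      rw [hσc, huw]; push_cast; linear_combination (w ^ 2 : F) * hs
    rw [this]
    exact hc.mul hσi)
  have hsi : IsIntegral ℤ s := by
    refine IsIntegral.of_pow two_pos ?_
    rw [hs]
    exact isIntegral_natCast _
  have hTs : (2 * c - T : F) = 2 * w * s := by
    have : (T : F) = 2 * u := by
      have := congrArg (fun q : ℚ => (q : F)) hT
      push_cast at this
      exact this.symm
    rw [this, huw]; ring
  -- A priori only $2wp=(2c-T)s$ is seen to be an integer $Z$. Since $Z^2=p(T^2-4n)$, the prime $p$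
  -- divides $Z$, and $2w$ is an integer too.
  obtain ⟨Z, hZ⟩ := exists_int_of_isIntegral (F := F) (q := 2 * w * p) (by
    have : ((2 * w * p : ℚ) : F) = ((c + c : F) - T) * s := by
      rw [← two_mul, hTs]
      push_cast
      linear_combination (-2 * w : F) * hs
    rw [this]
    exact ((hc.add hc).sub (isIntegral_algebraMap (x := T))).mul hsi)
  have hZ2 : Z ^ 2 = p * (T ^ 2 - 4 * n) := by
    have : (Z : ℚ) ^ 2 = p * (T ^ 2 - 4 * n) := by
      rw [← hZ, ← hT, ← hn]; ring
    exact_mod_cast this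
  have hpZ : (p : ℤ) ∣ Z :=
    (Nat.prime_iff_prime_int.1 hp).dvd_of_dvd_pow (n := 2) ⟨_, hZ2⟩
  obtain ⟨Y, hY⟩ := hpZ
  have hp0 : (p : ℚ) ≠ 0 := by exact_mod_cast hp.ne_zero
  have hwY : 2 * w = Y := by
    have : 2 * w * p = p * Y := by rw [hZ, hY]; push_cast; ring
    field_simp at this
    linarith
  refine ⟨T, n, Y, ?_, ?_⟩
  · have : (Y : F) = 2 * w := by
      have := congrArg (fun q : ℚ => (q : F)) hwY
      push_cast at this
      exact this.symm
    rw [this, ← hTs]; ring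
  · have : (T : ℚ) ^ 2 - p * Y ^ 2 = 4 * n := by
      rw [← hT, ← hwY, ← hn]; ring
    exact_mod_cast this

theorem isIntegral_of_coords (hs : s ^ 2 = (p : F)) {x : F} {T n Y : ℤ}
    (hx : 2 * x = T + Y * s) (h : T ^ 2 - p * Y ^ 2 = 4 * n) : IsIntegral ℤ x := by
  have h1 : x ^ 2 - T * x + n = 0 := by
    have h' : (T : F) ^ 2 - p * Y ^ 2 = 4 * n := by exact_mod_cast h
    linear_combination (x / 2 - T / 2 + (T + Y * s) / 4) * hx + (Y ^ 2 / 4 : F) * hs - (1 / 4 : F) * h'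
  refine ⟨Polynomial.X ^ 2 - Polynomial.C T * Polynomial.X + Polynomial.C n, ?_, ?_⟩
  · monicity!
  · simp only [Polynomial.eval₂_add, Polynomial.eval₂_sub, Polynomial.eval₂_mul,
      Polynomial.eval₂_pow, Polynomial.eval₂_X, Polynomial.eval₂_C]
    simpa using h1

theorem coords_unique (hp : p.Prime) (hs : s ^ 2 = (p : F)) {T Y T' Y' : ℤ}
    (h : (T + Y * s : F) = T' + Y' * s) : T = T' ∧ Y = Y' := by
  have := eq_and_eq_of_add_mul_eq hp hs (u := T) (w := Y) (u' := T') (w' := Y')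
    (by push_cast; exact h)
  exact_mod_cast this

/-- The hypotheses encode $c^2=qd$ for $c=(T+Y\sqrt p)/2$, $d=(T'+Y'\sqrt p)/2$ of norms $n,n'$,
with $q$ unramified. The conclusion provides an integral trace and norm for $c/q$. -/
theorem mul_dvd_of_coords {q : ℕ} (hp : p.Prime) (hq : q.Prime) (hqp : q ≠ p)
    (hq2 : q = 2 → p % 4 = 1) {T n Y T' n' Y' : ℤ} (h : T ^ 2 - p * Y ^ 2 = 4 * n)
    (h' : T' ^ 2 - p * Y' ^ 2 = 4 * n')
    (h1 : T ^ 2 + p * Y ^ 2 = 2 * q * T') (h2 : T * Y = q * Y') :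
    (q : ℤ) ∣ T ∧ (q : ℤ) ∣ Y ∧ (q : ℤ) ^ 2 ∣ n := by
  have hqi := Nat.prime_iff_prime_int.1 hq
  -- The norm of the relation $c^2=qd$.
  have hn : n ^ 2 = q ^ 2 * n' := by
    have : 16 * n ^ 2 = 16 * (q ^ 2 * n') := by
      linear_combination (-T ^ 2 + p * Y ^ 2 - 4 * n) * h + (4 * q ^ 2 : ℤ) * h' +
        (T ^ 2 + p * Y ^ 2 + 2 * q * T') * h1 - 4 * p * (T * Y + q * Y') * h2
    linarith
  have hqn : (q : ℤ) ∣ n := (Int.pow_dvd_pow_iff two_ne_zero).1 ⟨n', hn⟩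
  have hqT : (q : ℤ) ∣ T := by
    refine hqi.dvd_of_dvd_pow (n := 2) ?_
    have : T ^ 2 = q * T' + 2 * n := by linarith
    rw [this]
    exact dvd_add (dvd_mul_right _ _) (hqn.mul_left _)
  have hqY : (q : ℤ) ∣ Y := by
    refine hqi.dvd_of_dvd_pow (n := 2) ?_
    have h3 : (q : ℤ) ∣ p * Y ^ 2 := by
      have : p * Y ^ 2 = T ^ 2 - 4 * n := by linarith
      rw [this]
      exact dvd_sub (dvd_pow hqT two_ne_zero) (hqn.mul_left _)
    refine (hqi.dvd_or_dvd h3).resolve_left fun h4 => hqp ?_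
    exact (Nat.prime_dvd_prime_iff_eq hq hp).1 (by exact_mod_cast h4)
  refine ⟨hqT, hqY, ?_⟩
  obtain ⟨t, rfl⟩ := hqT
  obtain ⟨y, rfl⟩ := hqY
  rcases hq.eq_two_or_odd' with rfl | hodd
  -- For $q=2$ the factor $4$ in $4n$ hides the divisibility. With $T=2t$, $Y=2y$, evenness of
  -- $n=t^2-py^2$ forces $t\equiv y\bmod 2$, and $p\equiv1\bmod4$ then gives $4\mid n$.
  · have hp4 := hq2 rfl
    obtain ⟨k, hk⟩ : ∃ k, p = 4 * k + 1 := ⟨p / 4, by omega⟩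
    have h3 : t ^ 2 - p * y ^ 2 = n := by push_cast at h; linarith
    rw [hk] at h3
    push_cast at h3 hqn ⊢
    obtain ⟨m, rfl⟩ := hqn
    have hev : Even (t + y) := by
      have h4 : Even ((t + y) * (t + y)) :=
        ⟨m + 2 * k * y ^ 2 + y ^ 2 + t * y, by linarith⟩
      rcases Int.even_mul.1 h4 with h | h <;> exact h
    obtain ⟨e, he⟩ := hev
    obtain rfl : t = e + e - y := by linarith
    exact ⟨e ^ 2 - e * y - k * y ^ 2, by linarith⟩
  · have h3 : (q : ℤ) ^ 2 ∣ 4 * n := ⟨t ^ 2 - p * y ^ 2, by rw [← h]; ring⟩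
    refine IsCoprime.dvd_of_dvd_mul_left ?_ h3
    have : IsCoprime ((q : ℕ) : ℤ) ((2 : ℕ) : ℤ) :=
      Nat.isCoprime_iff_coprime.2 (Nat.coprime_two_right.2 hodd)
    have h4 := this.pow (m := 2) (n := 2)
    norm_num at h4
    exact h4

theorem dvd_of_dvd_sq (hp : p.Prime) (hs : s ^ 2 = (p : F))
    (hF : IntermediateField.adjoin ℚ {s} = ⊤) {q : ℕ} (hq : q.Prime) (hqp : q ≠ p)
    (hq2 : q = 2 → p % 4 = 1) {c : 𝓞 F} (hc : (q : 𝓞 F) ∣ c ^ 2) : (q : 𝓞 F) ∣ c := by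
  obtain ⟨d, hd⟩ := hc
  obtain ⟨T, n, Y, h1, h2⟩ := exists_int_coords hp hs hF c
  obtain ⟨T', n', Y', h1', h2'⟩ := exists_int_coords hp hs hF d
  have hd' : (c : F) ^ 2 = q * d := by exact_mod_cast congrArg (algebraMap (𝓞 F) F) hd
  have h3 : ((T ^ 2 + p * Y ^ 2 : ℤ) + (2 * T * Y : ℤ) * s : F) =
      (2 * q * T' : ℤ) + (2 * q * Y' : ℤ) * s := by
    push_cast
    linear_combination 4 * hd' - (2 * c + T + Y * s) * h1 + 2 * q * h1' - (Y ^ 2 : F) * hs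
  obtain ⟨h4, h5⟩ := coords_unique hp hs h3
  obtain ⟨⟨t, ht⟩, ⟨y, hy⟩, ⟨m, hm⟩⟩ := mul_dvd_of_coords hp hq hqp hq2 h2 h2' h4 (by linarith)
  have hq0 : (q : F) ≠ 0 := by exact_mod_cast hq.ne_zero
  have hq0' : (q : ℤ) ≠ 0 := by exact_mod_cast hq.ne_zero
  have hint : IsIntegral ℤ ((c : F) / q) := by
    refine isIntegral_of_coords hs (T := t) (Y := y) (n := m) ?_ ?_
    · rw [mul_div_assoc', h1, ht, hy]
      push_cast
      field_simp
    · have : (q : ℤ) ^ 2 * (t ^ 2 - p * y ^ 2) = q ^ 2 * (4 * m) := by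
        rw [ht, hy, hm] at h2
        linarith
      exact mul_left_cancel₀ (pow_ne_zero 2 hq0') this
  obtain ⟨e, he⟩ : ∃ e : 𝓞 F, (e : F) = c / q := ⟨⟨_, hint⟩, rfl⟩
  refine ⟨e, NumberField.RingOfIntegers.ext ?_⟩
  change (c : F) = algebraMap (𝓞 F) F (q * e)
  rw [map_mul, map_natCast]
  change (c : F) = q * (e : F)
  rw [he]
  field_simp

end

section

/-! ### Totally positive elements generating square ideals -/

/-- `x` is the square of a nonzero element up to units of the ring of integers. -/
def IsSqUpToUnits {F : Type*} [Field F] [NumberField F] (x : F) : Prop :=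
  ∃ γ : F, γ ≠ 0 ∧ ∀ v : HeightOneSpectrum (𝓞 F), v.valuation F x = v.valuation F γ ^ 2

/-- `x` generates the square of a fractional ideal. -/
def HasEvenValuations {F : Type*} [Field F] [NumberField F] (x : F) : Prop :=
  ∀ v : HeightOneSpectrum (𝓞 F), ∃ g : ℤᵐ⁰, v.valuation F x = g ^ 2

variable {p : ℕ} {F : Type*} [Field F] [NumberField F] {s : F}

theorem IsSqUpToUnits.mul {x y : F} (hx : IsSqUpToUnits x) (hy : IsSqUpToUnits y) :
    IsSqUpToUnits (x * y) := by
  obtain ⟨γ, h0, h⟩ := hx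
  obtain ⟨δ, h0', h'⟩ := hy
  exact ⟨γ * δ, mul_ne_zero h0 h0', fun v => by rw [map_mul, map_mul, h, h', mul_pow]⟩

theorem isSqUpToUnits_sq {x : F} (hx : x ≠ 0) : IsSqUpToUnits (x ^ 2) :=
  ⟨x, hx, fun _ => map_pow _ _ _⟩

theorem HasEvenValuations.mul_sq {x : F} (hx : HasEvenValuations x) (y : F) :
    HasEvenValuations (x * y ^ 2) := fun v => by
  obtain ⟨g, hg⟩ := hx v
  exact ⟨g * v.valuation F y, by rw [map_mul, map_pow, hg, mul_pow]⟩

theorem valuation_eq_one_of_mul_eq_one {x y : F} (hx : IsIntegral ℤ x) (hy : IsIntegral ℤ y)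
    (h : x * y = 1) (v : HeightOneSpectrum (𝓞 F)) : v.valuation F x = 1 := by
  have h1 : v.valuation F x ≤ 1 := v.valuation_le_one (⟨x, hx⟩ : 𝓞 F)
  have h2 : v.valuation F y ≤ 1 := v.valuation_le_one (⟨y, hy⟩ : 𝓞 F)
  refine le_antisymm h1 ?_
  rw [← map_one (v.valuation F), ← h, map_mul]
  exact mul_le_of_le_one_right' h2

/-- For a solution of $x^2-py^2=\pm2$, the element $(x+ys)^2/2$ is integral and its conjugate is its
inverse. It is therefore a unit, and $\gamma=x+ys$ works. -/
theorem isSqUpToUnits_two (hp : p.Prime) (hs : s ^ 2 = (p : F)) (hp4 : p % 4 = 3) :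
    IsSqUpToUnits (2 : F) := by
  obtain ⟨x, y, hxy⟩ := exists_sq_sub_mul_sq_eq_two hp hp4
  obtain ⟨ε, hε, hε2⟩ : ∃ ε : ℤ, x ^ 2 - p * y ^ 2 = 2 * ε ∧ ε ^ 2 = 1 := by
    rcases hxy with h | h
    exacts [⟨1, by rw [h]; norm_num, by norm_num⟩, ⟨-1, by rw [h]; norm_num, by norm_num⟩]
  have hε' : (x : F) ^ 2 - p * y ^ 2 = 2 * ε := by exact_mod_cast hε
  have hε2' : (ε : F) ^ 2 = 1 := by exact_mod_cast hε2
  have hprod : ∀ a b : F, a = ((x + y * s) ^ 2) / 2 → b = ((x - y * s) ^ 2) / 2 → a * b = 1 := by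
    rintro a b rfl rfl
    have h1 : (x + y * s : F) * (x - y * s) = 2 * ε := by
      rw [← hε']; linear_combination (-y ^ 2 : F) * hs
    field_simp
    linear_combination ((x + y * s : F) * (x - y * s) + 2 * ε) * h1 + 4 * hε2'
  have hint : ∀ y : ℤ, x ^ 2 - p * y ^ 2 = 2 * ε → IsIntegral ℤ (((x + y * s : F) ^ 2) / 2) := by
    intro y hε
    refine isIntegral_of_coords hs (T := 2 * (x ^ 2 - ε)) (Y := 2 * x * y) (n := ε ^ 2) ?_ ?_
    · have hε' : (x : F) ^ 2 - p * y ^ 2 = 2 * ε := by exact_mod_cast hε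
      push_cast
      linear_combination (y ^ 2 : F) * hs - hε'
    · linear_combination (4 * x ^ 2) * hε
  have hn : (x + y * s : F) ≠ 0 := by
    intro h0
    have := hprod _ _ rfl rfl
    rw [h0] at this
    simp at this
  refine ⟨x + y * s, hn, fun v => ?_⟩
  have h1 := valuation_eq_one_of_mul_eq_one (hint y hε)
    (y := ((x - y * s : F) ^ 2) / 2) (by
      have := hint (-y) (by rw [neg_sq, hε])
      push_cast at this
      rwa [neg_mul, ← sub_eq_add_neg] at this) (hprod _ _ rfl rfl) v
  rw [map_div₀, map_pow] at h1
  have h2 : v.valuation F (2 : F) ≠ 0 := by simp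
  exact ((div_eq_one_iff_eq h2).1 h1).symm

/-- Only ramified primes can divide $m$: for unramified $q$ the ideal $(q)$ is radical, so
$J^2\subseteq(q)$ gives $J\subseteq(q)$, whence $q^2\mid m$, contradicting squarefreeness. -/
theorem isSqUpToUnits_prime (hp : p.Prime) (hs : s ^ 2 = (p : F))
    (hF : IntermediateField.adjoin ℚ {s} = ⊤) {m : ℕ} (hm : Squarefree m) {J : Ideal (𝓞 F)}
    (hJ : J ^ 2 = Ideal.span {(m : 𝓞 F)}) {q : ℕ} (hq : q.Prime) (hqm : q ∣ m) :
    IsSqUpToUnits (q : F) := by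
  by_cases hqp : q = p
  · have hs0 : s ≠ 0 := by
      rintro rfl
      rw [zero_pow two_ne_zero] at hs
      exact hp.ne_zero (by exact_mod_cast hs.symm)
    rw [hqp, ← hs]
    exact isSqUpToUnits_sq hs0
  by_cases hq2 : q = 2 ∧ p % 4 = 3
  · rw [hq2.1]
    exact_mod_cast isSqUpToUnits_two hp hs hq2.2
  exfalso
  have hq2' : q = 2 → p % 4 = 1 := by
    rintro rfl
    rcases hp.eq_two_or_odd with h | h <;> omega
  have hJq : J ≤ Ideal.span {(q : 𝓞 F)} := by
    intro c hc
    rw [Ideal.mem_span_singleton]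
    refine dvd_of_dvd_sq hp hs hF hq hqp hq2' ?_
    have h1 : c ^ 2 ∈ Ideal.span {(m : 𝓞 F)} := hJ ▸ Ideal.pow_mem_pow hc 2
    rw [Ideal.mem_span_singleton] at h1
    exact (Nat.cast_dvd_cast hqm).trans h1
  have h2 : (m : 𝓞 F) ∈ Ideal.span {(q : 𝓞 F) ^ 2} := by
    rw [← Ideal.span_singleton_pow]
    exact Ideal.pow_right_mono hJq 2 (hJ ▸ Ideal.mem_span_singleton_self _)
  obtain ⟨d, hd⟩ := Ideal.mem_span_singleton.1 h2
  have hq0 : (q : F) ≠ 0 := by exact_mod_cast hq.ne_zero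
  obtain ⟨n, hn⟩ := exists_int_of_isIntegral (F := F) (q := (m / q ^ 2 : ℚ)) (by
    have : ((m / q ^ 2 : ℚ) : F) = d := by
      have hd' : (m : F) = q ^ 2 * d := by exact_mod_cast congrArg (algebraMap (𝓞 F) F) hd
      push_cast
      rw [hd']
      field_simp
    rw [this]
    exact d.2)
  have h3 : (q * q : ℤ) ∣ m := by
    refine ⟨n, ?_⟩
    have hq0 : (q : ℚ) ≠ 0 := by exact_mod_cast hq.ne_zero
    have : (m : ℚ) = q * q * n := by
      rw [← hn]; field_simp
    exact_mod_cast this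
  exact hq.not_isUnit (hm q (by exact_mod_cast h3))

theorem isSqUpToUnits_squarefree (hp : p.Prime) (hs : s ^ 2 = (p : F))
    (hF : IntermediateField.adjoin ℚ {s} = ⊤) {m : ℕ} (hm : Squarefree m)
    (h : HasEvenValuations (m : F)) : IsSqUpToUnits (m : F) := by
  have hm0 : (m : 𝓞 F) ≠ 0 := by exact_mod_cast hm.ne_zero
  obtain ⟨J, hJ⟩ := exists_sq_eq_span_of_valuation_sq (K := F) hm0 (by simpa using! h)
  rw [← Nat.prod_primeFactors_of_squarefree hm, Nat.cast_prod]
  refine Finset.prod_induction _ IsSqUpToUnits (fun _ _ => IsSqUpToUnits.mul) ?_ fun q hq => ?_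
  · simpa using isSqUpToUnits_sq (one_ne_zero (α := F))
  · exact isSqUpToUnits_prime hp hs hF hm hJ (Nat.prime_of_mem_primeFactors hq)
      (Nat.dvd_of_mem_primeFactors hq)

/-- Modulo rational squares, $k$ equals numerator times denominator, and hence the squarefree part
$m$ of that product. -/
theorem isSqUpToUnits_rat (hp : p.Prime) (hs : s ^ 2 = (p : F))
    (hF : IntermediateField.adjoin ℚ {s} = ⊤) {k : ℚ} (hk : 0 < k)
    (h : HasEvenValuations (k : F)) : IsSqUpToUnits (k : F) := by
  have hpos : 0 < k.num.toNat * k.den :=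
    Nat.mul_pos (by simpa using Rat.num_pos.2 hk) k.den_pos
  obtain ⟨m, r, hm, hr, hmr, hsf⟩ := Nat.sq_mul_squarefree_of_pos hpos
  have hkden : (k.den : ℚ) ≠ 0 := by exact_mod_cast k.den_ne_zero
  have hr0 : (r : ℚ) ≠ 0 := by exact_mod_cast hr.ne'
  have hkm : k = m * (r / k.den : ℚ) ^ 2 := by
    have h1 : (k.num.toNat : ℚ) = k.num := by
      exact_mod_cast Int.toNat_of_nonneg (Rat.num_pos.2 hk).le
    have h2 : (r : ℚ) ^ 2 * m = k.num * k.den := by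
      rw [← h1]; exact_mod_cast hmr
    conv_lhs => rw [← Rat.num_div_den k]
    field_simp
    linarith
  have hkm' : (k : F) = m * ((r / k.den : ℚ) : F) ^ 2 := by
    conv_lhs => rw [hkm]
    push_cast
    rfl
  have hc0 : ((r / k.den : ℚ) : F) ≠ 0 := by
    rw [Rat.cast_ne_zero]
    exact div_ne_zero hr0 hkden
  have hmk : (m : F) = k * (((r / k.den : ℚ) : F)⁻¹) ^ 2 := by
    rw [hkm']
    field_simp
  rw [hkm']
  refine (isSqUpToUnits_squarefree hp hs hF hsf ?_).mul (isSqUpToUnits_sq hc0)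
  rw [hmk]
  exact h.mul_sq _

theorem exists_sq_norm_eq_sq_of_hasEvenValuations {t : F} (ht : t ≠ 0)
    (h : HasEvenValuations t) : ∃ n : ℚ, 0 < n ∧ |Algebra.norm ℚ t| = n ^ 2 := by
  obtain ⟨r, d, hd, rfl⟩ := IsFractionRing.div_surjective (A := 𝓞 F) t
  have hd0 : algebraMap (𝓞 F) F d ≠ 0 := by simpa using nonZeroDivisors.ne_zero hd
  have hr0 : algebraMap (𝓞 F) F r ≠ 0 := fun h => ht (by rw [h, zero_div])
  have hrd : algebraMap (𝓞 F) F (r * d) ≠ 0 := by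
    rw [map_mul]; exact mul_ne_zero hr0 hd0
  have hrd' : r * d ≠ 0 := by simpa using hrd
  -- Multiplying $t=r/d$ by $d^2$ gives the integer $rd$ without changing parities of valuations.
  -- The norm of $t$ is then read off from that of $J$.
  obtain ⟨J, hJ⟩ := exists_sq_eq_span_of_valuation_sq (K := F) hrd' (by
    have := h.mul_sq (algebraMap (𝓞 F) F d)
    rwa [show algebraMap (𝓞 F) F r / algebraMap (𝓞 F) F d * algebraMap (𝓞 F) F d ^ 2 =
      algebraMap (𝓞 F) F (r * d) by rw [map_mul]; field_simp] at this)
  have h1 := congrArg Ideal.absNorm hJ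
  rw [map_pow, Ideal.absNorm_span_singleton] at h1
  have h2 : |Algebra.norm ℚ (algebraMap (𝓞 F) F (r * d))| = (Ideal.absNorm J : ℚ) ^ 2 := by
    have h3 := Algebra.coe_norm_int (r * d)
    change _ = Algebra.norm ℚ (algebraMap (𝓞 F) F (r * d)) at h3
    rw [← h3]
    zify at h1
    exact_mod_cast h1.symm
  have hN : Algebra.norm ℚ (algebraMap (𝓞 F) F d) ≠ 0 := Algebra.norm_ne_zero_iff.2 hd0
  have hJ0 : (Ideal.absNorm J : ℚ) ≠ 0 := by
    intro h0
    rw [h0, zero_pow two_ne_zero, abs_eq_zero] at h2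
    exact Algebra.norm_ne_zero_iff.2 hrd h2
  refine ⟨Ideal.absNorm J / |Algebra.norm ℚ (algebraMap (𝓞 F) F d)|, ?_, ?_⟩
  · have : (0 : ℚ) < Ideal.absNorm J := lt_of_le_of_ne (by positivity) hJ0.symm
    positivity
  · have h4 : Algebra.norm ℚ (algebraMap (𝓞 F) F r / algebraMap (𝓞 F) F d) *
        Algebra.norm ℚ (algebraMap (𝓞 F) F d) = Algebra.norm ℚ (algebraMap (𝓞 F) F r) := by
      rw [← map_mul, div_mul_cancel₀ _ hd0]
    rw [div_pow, ← h2, map_mul, map_mul, ← h4, abs_mul, abs_mul]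
    field_simp

/-- An explicit Hilbert 90: since $tt'=n^2$, the element $t/n$ has norm $1$, and
$t(t+t'+2n)=(t+n)^2$ makes $t$ a positive rational times a square. Total positivity ensures
$N(t)=+n^2$ and $t+t'+2n>0$. -/
theorem isSqUpToUnits_of_totallyPositive (hp : p.Prime) (hs : s ^ 2 = (p : F))
    (hF : IntermediateField.adjoin ℚ {s} = ⊤) {t : F} (ht : ∀ σ : F →+* ℝ, 0 < σ t)
    (h : HasEvenValuations t) : IsSqUpToUnits t := by
  have hp0 : (0 : ℝ) ≤ p := by positivity
  obtain ⟨σ, hσ⟩ := exists_ringHom hp hs hF (K := ℝ) (r := √p) (Real.sq_sqrt hp0)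
  obtain ⟨τ, hτ⟩ := exists_ringHom hp hs hF (K := ℝ) (r := -√p) (by
    rw [neg_sq, Real.sq_sqrt hp0])
  obtain ⟨u, w, rfl⟩ := exists_eq_add_mul hs hF t
  have h1 := ht σ
  have h2 := ht τ
  simp only [map_add, map_mul, map_ratCast, hσ, hτ] at h1 h2
  have hu : 0 < u := by
    have : (0 : ℝ) < u := by linarith
    exact_mod_cast this
  have hN : 0 < u ^ 2 - p * w ^ 2 := by
    have h3 : (0 : ℝ) < (u + w * √p) * (u + w * -√p) := mul_pos h1 h2
    have h4 : ((u : ℝ) + w * √p) * (u + w * -√p) = u ^ 2 - p * w ^ 2 := by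
      linear_combination (-w ^ 2 : ℝ) * Real.sq_sqrt hp0
    rw [h4] at h3
    exact_mod_cast h3
  have ht0 : (u + w * s : F) ≠ 0 := fun h0 => by
    have := ht σ
    rw [h0, map_zero] at this
    exact lt_irrefl _ this
  obtain ⟨n, hn0, hn⟩ := exists_sq_norm_eq_sq_of_hasEvenValuations ht0 h
  rw [norm_add_mul hp hs hF, abs_of_pos hN] at hn
  have hn' : (u : F) ^ 2 - p * w ^ 2 = n ^ 2 := by exact_mod_cast hn
  set k : ℚ := 2 * (u + n) with hk
  have hk0 : 0 < k := by positivity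
  have hkF : (k : F) ≠ 0 := by simpa using hk0.ne'
  have key : (u + w * s : F) * k = (u + w * s + n) ^ 2 := by
    rw [hk]; push_cast
    linear_combination hn' - (w ^ 2 : F) * hs
  have hβ : (u + w * s + n : F) ≠ 0 := by
    intro h0
    rw [h0, zero_pow two_ne_zero] at key
    exact mul_ne_zero ht0 hkF key
  have hk1 : (k : F) = (u + w * s) * ((u + w * s + n) / (u + w * s)) ^ 2 := by
    field_simp
    linear_combination key
  have hk2 : (u + w * s : F) = k * ((u + w * s + n) / k) ^ 2 := by
    field_simp
    linear_combination key
  have hkeven : HasEvenValuations (k : F) := by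
    rw [hk1]
    exact h.mul_sq _
  rw [hk2]
  exact (isSqUpToUnits_rat hp hs hF hk0 hkeven).mul (isSqUpToUnits_sq (div_ne_zero hβ hkF))

end

section

/-! ### Reduced norms -/

theorem nr_mul {R : Type*} [CommRing R] {a b : R} (x y : ℍ[R, a, b]) :
    nr (x * y) = nr x * nr y := by
  rw [nr_eq, nr_eq, nr_eq]
  simp
  ring

/-- The reduced norm as a monoid homomorphism. -/
def nrHom {R : Type*} [CommRing R] (a b : R) : ℍ[R, a, b] →* R where
  toFun := nr
  map_one' := by simp [nr_eq]
  map_mul' := nr_mul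

/-- If $A\ge0$, then $(i-\sqrt A)(i+\sqrt A)=0$ yields zero divisors, which a division algebra does
not have. -/
theorem left_neg_of_algEquiv {A B : ℝ} (φ : ℍ[ℝ, A, B] ≃ₐ[ℝ] ℍ[ℝ]) : A < 0 := by
  by_contra h
  have hA : √A * √A = A := Real.mul_self_sqrt (not_lt.1 h)
  have h1 : (⟨-√A, 1, 0, 0⟩ : ℍ[ℝ, A, B]) * ⟨√A, 1, 0, 0⟩ = 0 := by
    ext <;> simp [hA]
  have h2 := congrArg φ h1
  rw [map_mul, map_zero, mul_eq_zero, map_eq_zero_iff φ φ.injective,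
    map_eq_zero_iff φ φ.injective] at h2
  rcases h2 with h2 | h2 <;> simpa using congrArg QuaternionAlgebra.imI h2

theorem right_neg_of_algEquiv {A B : ℝ} (φ : ℍ[ℝ, A, B] ≃ₐ[ℝ] ℍ[ℝ]) : B < 0 := by
  by_contra h
  have hB : √B * √B = B := Real.mul_self_sqrt (not_lt.1 h)
  have h1 : (⟨-√B, 0, 1, 0⟩ : ℍ[ℝ, A, B]) * ⟨√B, 0, 1, 0⟩ = 0 := by
    ext <;> simp [hB]
  have h2 := congrArg φ h1
  rw [map_mul, map_zero, mul_eq_zero, map_eq_zero_iff φ φ.injective,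
    map_eq_zero_iff φ φ.injective] at h2
  rcases h2 with h2 | h2 <;> simpa using congrArg QuaternionAlgebra.imJ h2

theorem IsTotallyDefinite.nr_pos {F : Type*} [Field F] {a b : F} (h : IsTotallyDefinite a b)
    {x : Quat a b} (hx : x ≠ 0) (σ : F →+* ℝ) : 0 < σ (nr x) := by
  obtain ⟨φ⟩ := h σ
  have ha := left_neg_of_algEquiv φ
  have hb := right_neg_of_algEquiv φ
  have hab : 0 < σ a * σ b := mul_pos_of_neg_of_neg ha hb
  rw [nr_eq]
  simp only [map_add, map_sub, map_mul, map_pow]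
  have h1 := sq_nonneg (σ x.re)
  have h2 : 0 ≤ -σ a * σ x.imI ^ 2 := mul_nonneg (by linarith) (sq_nonneg _)
  have h3 : 0 ≤ -σ b * σ x.imJ ^ 2 := mul_nonneg (by linarith) (sq_nonneg _)
  have h4 : 0 ≤ σ a * σ b * σ x.imK ^ 2 := mul_nonneg hab.le (sq_nonneg _)
  by_contra hneg
  refine hx (QuaternionAlgebra.ext ?_ ?_ ?_ ?_)
  · have : σ x.re ^ 2 = 0 := by linarith
    simpa using this
  · have : -σ a * σ x.imI ^ 2 = 0 := by linarith
    simpa [ha.ne] using this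
  · have : -σ b * σ x.imJ ^ 2 = 0 := by linarith
    simpa [hb.ne] using this
  · have : σ a * σ b * σ x.imK ^ 2 = 0 := by linarith
    simpa [hab.ne', ha.ne, hb.ne] using this

variable {F : Type*} [Field F] [NumberField F] {a b : F}

theorem nr_toQuatOver (x : Quat a b) :
    nr (toQuatOver (FinAdele F) a b x) = algebraMap F (FinAdele F) (nr x) := by
  rw [nr_eq, nr_eq]
  simp [toQuatOver]

theorem toQuatOver_smul_field (r : F) (x : Quat a b) :
    toQuatOver (FinAdele F) a b (r • x) =
      algebraMap F (FinAdele F) r • toQuatOver (FinAdele F) a b x := by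
  have key : ∀ c : F, algebraMap F (FinAdele F) (r • c) =
      algebraMap F (FinAdele F) r • algebraMap F (FinAdele F) c :=
    fun c => map_mul _ _ _
  exact QuaternionAlgebra.ext (key _) (key _) (key _) (key _)

/-- The canonical map on unit groups. -/
abbrev unitsToAdelic (a b : F) : (Quat a b)ˣ →* (AdelicQuat a b)ˣ :=
  Units.map (toQuatOver (FinAdele F) a b : Quat a b →* AdelicQuat a b)

theorem coe_unitsToAdelic (α : (Quat a b)ˣ) :
    (unitsToAdelic a b α : AdelicQuat a b) = toQuatOver (FinAdele F) a b α := rfl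

theorem coe_unitsToAdelic_inv (α : (Quat a b)ˣ) :
    ((unitsToAdelic a b α)⁻¹ : (AdelicQuat a b)ˣ) =
      toQuatOver (FinAdele F) a b (α⁻¹ : (Quat a b)ˣ) := rfl

theorem exists_nr_eq_of_mem_spinorUnits {x : (AdelicQuat a b)ˣ} (hx : x ∈ spinorUnits a b) :
    ∃ ξ : (Quat a b)ˣ, Units.map (nrHom _ _) x = Units.map (nrHom _ _) (unitsToAdelic a b ξ) := by
  obtain ⟨ξ, y, hy, rfl⟩ := hx
  refine ⟨ξ, ?_⟩
  have : Units.map (nrHom _ _) y = 1 := Units.ext hy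
  rw [map_mul, this, mul_one]

/-! ### Multiplying adelic lattices by units -/

/-- The map `z ↦ x z y` on adelic quaternions. -/
def sandwich (x y : AdelicQuat a b) : AdelicQuat a b →ₗ[integralAdeles F] AdelicQuat a b where
  toFun z := x * z * y
  map_add' z w := by rw [mul_add, add_mul]
  map_smul' c z := by rw [mul_smul_comm_quat, smul_mul_assoc_quat]; rfl

theorem sandwich_apply (x y z : AdelicQuat a b) : sandwich x y z = x * z * y := rfl

theorem exists_integer_smul_sandwich_mem (x y : AdelicQuat a b) :
    ∃ N : 𝓞 F, N ≠ 0 ∧ ∀ z ∈ stdHat a b, intEmb N • sandwich x y z ∈ stdHat a b := by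
  obtain ⟨N, hN, h⟩ := exists_integer_smul_mem_stdHat_finset Finset.univ
    fun i => sandwich x y (stdBasis _ _ i)
  refine ⟨N, hN, fun z hz => ?_⟩
  rw [← map_smul]
  refine stdHat_le (M := (stdHat a b).comap (sandwich x y)) (fun i => ?_) hz
  rw [Submodule.mem_comap, map_smul]
  exact h i (Finset.mem_univ i)

theorem IsAdelicLattice.map_sandwich {M : Submodule (integralAdeles F) (AdelicQuat a b)}
    (hM : IsAdelicLattice M) (x y : (AdelicQuat a b)ˣ) :
    IsAdelicLattice (M.map (sandwich (x : AdelicQuat a b) y)) := by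
  obtain ⟨N, hN, h1, h2⟩ := hM
  obtain ⟨m, hm, hm'⟩ := exists_integer_smul_sandwich_mem (x : AdelicQuat a b) y
  obtain ⟨n, hn, hn'⟩ := exists_integer_smul_sandwich_mem ((x⁻¹ : (AdelicQuat a b)ˣ) :
    AdelicQuat a b) (y⁻¹ : (AdelicQuat a b)ˣ)
  refine ⟨m * (N * n), mul_ne_zero hm (mul_ne_zero hN hn), fun z hz => ?_, ?_⟩
  · rw [map_mul, mul_smul]
    refine Submodule.smul_mem _ _ ⟨_, h1 _ (hn' z hz), ?_⟩
    rw [map_smul, map_smul, smul_smul, ← map_mul]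
    congr 1
    simp [sandwich_apply, mul_assoc]
  · rintro _ ⟨z, hz, rfl⟩
    have h3 := hm' _ (h2 z hz)
    rw [mul_comm N n, mul_left_comm, map_mul, mul_smul, map_mul, mul_smul]
    rw [map_smul] at h3
    exact Submodule.smul_mem _ _ h3

/-! ### Left orders -/

theorem mem_hat_iff_of_locally_principal {O : Subalgebra (𝓞 F) (Quat a b)}
    {I : Submodule (𝓞 F) (Quat a b)} {x : (AdelicQuat a b)ˣ}
    (h : (hat I : Set (AdelicQuat a b)) =
      (fun y => (x : AdelicQuat a b) * y) '' (hat (Subalgebra.toSubmodule O) : Set (AdelicQuat a b)))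
    {w : AdelicQuat a b} :
    w ∈ hat I ↔ ((x⁻¹ : (AdelicQuat a b)ˣ) : AdelicQuat a b) * w ∈
      hat (Subalgebra.toSubmodule O) := by
  rw [← SetLike.mem_coe, h]
  constructor
  · rintro ⟨y, hy, rfl⟩
    simpa using hy
  · intro hw
    exact ⟨_, hw, by simp⟩

theorem mem_map_sandwich_inv_iff {M : Submodule (integralAdeles F) (AdelicQuat a b)}
    {x : (AdelicQuat a b)ˣ} {w : AdelicQuat a b} :
    w ∈ M.map (sandwich (x : AdelicQuat a b) (x⁻¹ : (AdelicQuat a b)ˣ)) ↔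
      ((x⁻¹ : (AdelicQuat a b)ˣ) : AdelicQuat a b) * w * x ∈ M := by
  constructor
  · rintro ⟨y, hy, rfl⟩
    simpa [sandwich_apply, mul_assoc] using hy
  · intro hw
    exact ⟨_, hw, by simp [sandwich_apply, mul_assoc]⟩

/-- An $\alpha\in D$ preserves $I$ exactly when it preserves $x\widehat{\mathbb O}$. As
$1\in\widehat{\mathbb O}$, it is enough to test on $x$ itself. -/
theorem globalPart_map_sandwich_eq_leftOrder {O : Subalgebra (𝓞 F) (Quat a b)}
    {I : Submodule (𝓞 F) (Quat a b)} (hI : I.IsLattice F) {x : (AdelicQuat a b)ˣ}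
    (h : (hat I : Set (AdelicQuat a b)) =
      (fun y => (x : AdelicQuat a b) * y) '' (hat (Subalgebra.toSubmodule O) : Set (AdelicQuat a b))) :
    globalPart ((hat (Subalgebra.toSubmodule O)).map
      (sandwich (x : AdelicQuat a b) (x⁻¹ : (AdelicQuat a b)ˣ))) =
        Subalgebra.toSubmodule (leftOrder I) := by
  ext α
  rw [mem_globalPart, mem_map_sandwich_inv_iff]
  constructor
  · intro hα y hy
    rw [← globalPart_hat hI, mem_globalPart, map_mul, mem_hat_iff_of_locally_principal h]
    have := mul_mem_hat O hα ((mem_hat_iff_of_locally_principal h).1 (toQuatOver_mem_hat hy))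
    simpa [mul_assoc] using this
  · intro hα
    have hx : (x : AdelicQuat a b) ∈ hat I := by
      rw [mem_hat_iff_of_locally_principal h, Units.inv_mul]
      exact one_mem_hat O
    have := mul_mem_hat_of_mul_mem (I := Subalgebra.toSubmodule (leftOrder I)) (J := I) (K := I)
      (fun β hβ y hy => hβ y hy) (toQuatOver_mem_hat hα) hx
    rw [mem_hat_iff_of_locally_principal h, ← mul_assoc] at this
    exact this

theorem isOrder_leftOrder {O : Subalgebra (𝓞 F) (Quat a b)} (hO : IsOrder O)
    {I : Submodule (𝓞 F) (Quat a b)} (hI : I.IsLattice F) {x : (AdelicQuat a b)ˣ}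
    (h : (hat I : Set (AdelicQuat a b)) =
      (fun y => (x : AdelicQuat a b) * y) '' (hat (Subalgebra.toSubmodule O) : Set (AdelicQuat a b))) :
    IsOrder (leftOrder I) := by
  rw [IsOrder, ← globalPart_map_sandwich_eq_leftOrder hI h]
  exact isLattice_globalPart ((isAdelicLattice_hat hO).map_sandwich _ _)

theorem hat_leftOrder {O : Subalgebra (𝓞 F) (Quat a b)} (hO : IsOrder O)
    {I : Submodule (𝓞 F) (Quat a b)} (hI : I.IsLattice F) {x : (AdelicQuat a b)ˣ}
    (h : (hat I : Set (AdelicQuat a b)) =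
      (fun y => (x : AdelicQuat a b) * y) '' (hat (Subalgebra.toSubmodule O) : Set (AdelicQuat a b))) :
    hat (Subalgebra.toSubmodule (leftOrder I)) = (hat (Subalgebra.toSubmodule O)).map
      (sandwich (x : AdelicQuat a b) (x⁻¹ : (AdelicQuat a b)ˣ)) := by
  rw [← globalPart_map_sandwich_eq_leftOrder hI h]
  exact hat_globalPart ((isAdelicLattice_hat hO).map_sandwich _ _)

theorem leftOrder_mem_spinorGenus {O : Subalgebra (𝓞 F) (Quat a b)} (hO : IsOrder O)
    {I : Submodule (𝓞 F) (Quat a b)} (hI : I ∈ principalSpinorClass O) :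
    leftOrder I ∈ spinorGenus O := by
  obtain ⟨h1, x, hx, h⟩ := hI
  refine ⟨isOrder_leftOrder hO h1.isLattice h, x, hx, ?_⟩
  rw [hat_leftOrder hO h1.isLattice h]
  rfl

theorem exists_leftOrder_eq {O : Subalgebra (𝓞 F) (Quat a b)} (hO : IsOrder O)
    {O' : Subalgebra (𝓞 F) (Quat a b)} (hO' : O' ∈ spinorGenus O) :
    ∃ I ∈ principalSpinorClass O, leftOrder I = O' := by
  obtain ⟨h1, x, hx, h⟩ := hO'
  set M := (hat (Subalgebra.toSubmodule O)).map (sandwich (x : AdelicQuat a b) (1 : (AdelicQuat a b)ˣ))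
    with hM
  have hlat : IsAdelicLattice M := (isAdelicLattice_hat hO).map_sandwich _ _
  have hI := isLattice_globalPart hlat
  have hhat : (hat (globalPart M) : Set (AdelicQuat a b)) =
      (fun y => (x : AdelicQuat a b) * y) ''
        (hat (Subalgebra.toSubmodule O) : Set (AdelicQuat a b)) := by
    rw [hat_globalPart hlat, hM, Submodule.map_coe]
    refine Set.image_congr fun y _ => ?_
    simp [sandwich_apply]
  refine ⟨globalPart M, ⟨⟨hI, fun y hy u hu => ?_, x, hhat⟩, x, hx, hhat⟩, ?_⟩
  · rw [← globalPart_hat hI, mem_globalPart, map_mul]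
    rw [← globalPart_hat hI, mem_globalPart] at hy
    rw [mem_hat_iff_of_locally_principal hhat] at hy ⊢
    rw [← mul_assoc]
    exact mul_mem_hat O hy (toQuatOver_mem_hat (I := Subalgebra.toSubmodule O) hu)
  · apply Subalgebra.toSubmodule_injective
    rw [← globalPart_map_sandwich_eq_leftOrder hI hhat, ← globalPart_hat h1]
    congr 1
    apply SetLike.coe_injective
    rw [h]
    rfl

end

section

/-! ### Classes and types -/

variable {F : Type*} [Field F] {a b : F}

theorem mem_idealClass_self (I : Submodule (𝓞 F) (Quat a b)) : I ∈ idealClass I :=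
  ⟨1, by simp⟩

theorem mem_typeOf_self (O : Subalgebra (𝓞 F) (Quat a b)) : O ∈ typeOf O :=
  ⟨1, by simp⟩

theorem idealClass_eq_of_mem {I J : Submodule (𝓞 F) (Quat a b)} (h : J ∈ idealClass I) :
    idealClass I = idealClass J := by
  obtain ⟨α, h⟩ := h
  ext K
  constructor
  · rintro ⟨β, hβ⟩
    refine ⟨β * α⁻¹, ?_⟩
    rw [hβ, h, Set.image_image]
    refine Set.image_congr fun y _ => ?_
    simp [mul_assoc]
  · rintro ⟨β, hβ⟩
    refine ⟨β * α, ?_⟩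
    rw [hβ, h, Set.image_image]
    refine Set.image_congr fun y _ => ?_
    simp [mul_assoc]

theorem typeOf_eq_of_mem {O O' : Subalgebra (𝓞 F) (Quat a b)} (h : O' ∈ typeOf O) :
    typeOf O = typeOf O' := by
  obtain ⟨α, h⟩ := h
  ext K
  constructor
  · rintro ⟨β, hβ⟩
    refine ⟨β * α⁻¹, ?_⟩
    rw [hβ, h, Set.image_image]
    refine Set.image_congr fun y _ => ?_
    simp [mul_assoc]
  · rintro ⟨β, hβ⟩
    refine ⟨β * α, ?_⟩
    rw [hβ, h, Set.image_image]
    refine Set.image_congr fun y _ => ?_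
    simp [mul_assoc]

theorem leftOrder_mem_typeOf {I J : Submodule (𝓞 F) (Quat a b)} (h : J ∈ idealClass I) :
    leftOrder J ∈ typeOf (leftOrder I) := by
  obtain ⟨α, h⟩ := h
  have hmem : ∀ y, y ∈ J ↔ ((α⁻¹ : (Quat a b)ˣ) : Quat a b) * y ∈ I := by
    intro y
    rw [← SetLike.mem_coe, h]
    constructor
    · rintro ⟨z, hz, rfl⟩
      simpa using hz
    · intro hz
      exact ⟨_, hz, by simp⟩
  refine ⟨α, ?_⟩
  ext β
  constructor
  · intro hβ
    refine ⟨(α⁻¹ : (Quat a b)ˣ) * β * α, fun y hy => ?_, by simp [mul_assoc]⟩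
    have h1 := hβ (α * y) ((hmem _).2 (by simpa using hy))
    rw [hmem] at h1
    simpa [mul_assoc] using h1
  · rintro ⟨γ, hγ, rfl⟩ y hy
    rw [hmem] at hy ⊢
    have := hγ _ hy
    simpa [mul_assoc] using this

variable [NumberField F]

theorem mem_idealClass_of_leftOrder_mem_typeOf {p : ℕ} (hp : p.Prime) {s : F}
    (hs : s ^ 2 = (p : F)) (hF : IntermediateField.adjoin ℚ {s} = ⊤)
    (hD : IsRamifiedExactlyAtInfinity a b) {O : Subalgebra (𝓞 F) (Quat a b)}
    (hO : IsMaximalOrder O) {I J : Submodule (𝓞 F) (Quat a b)} (hI : I ∈ principalSpinorClass O)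
    (hJ : J ∈ principalSpinorClass O) (h : leftOrder J ∈ typeOf (leftOrder I)) :
    J ∈ idealClass I := by
  obtain ⟨hI, x, hx, hIx⟩ := hI
  obtain ⟨hJ, y, hy, hJy⟩ := hJ
  obtain ⟨α, hα⟩ := h
  obtain ⟨ξ, hξ⟩ := exists_nr_eq_of_mem_spinorUnits hx
  obtain ⟨η, hη⟩ := exists_nr_eq_of_mem_spinorUnits hy
  set A := unitsToAdelic a b α with hA
  -- The element $z$ normalizes $\widehat{\mathbb O}$. The global $\delta$ is built from $\xi,\eta$,
  -- whose reduced norms are those of $x,y$, so that $\mathrm{Nr}(z)=\mathrm{Nr}(\delta)$.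
  set z : (AdelicQuat a b)ˣ := (A * x)⁻¹ * y with hz
  set δ : (Quat a b)ˣ := (α * ξ)⁻¹ * η with hδ
  have hnr : nr (z : AdelicQuat a b) = algebraMap F (FinAdele F) (nr (δ : Quat a b)) := by
    have : Units.map (nrHom _ _) z = Units.map (nrHom _ _) (unitsToAdelic a b δ) := by
      simp only [hz, hδ, map_mul, map_inv, hξ, hη, hA]
    rw [← nr_toQuatOver]
    exact congrArg Units.val this
  have hle : hat (Subalgebra.toSubmodule (leftOrder J)) ≤ (hat (Subalgebra.toSubmodule O)).map
      (sandwich ((A * x : (AdelicQuat a b)ˣ) : AdelicQuat a b)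
        ((A * x)⁻¹ : (AdelicQuat a b)ˣ)) := by
    refine Submodule.span_le.2 ?_
    rintro _ ⟨β, hβ, rfl⟩
    have hβ' : β ∈ (leftOrder J : Set (Quat a b)) := hβ
    rw [hα] at hβ'
    obtain ⟨β', hβ', rfl⟩ := hβ'
    have h1 : toQuatOver (FinAdele F) a b β' ∈ hat (Subalgebra.toSubmodule (leftOrder I)) :=
      toQuatOver_mem_hat hβ'
    rw [hat_leftOrder hO.prop hI.isLattice hIx, mem_map_sandwich_inv_iff] at h1
    rw [SetLike.mem_coe, mem_map_sandwich_inv_iff]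
    convert h1 using 1
    rw [map_mul, map_mul, ← coe_unitsToAdelic, ← coe_unitsToAdelic_inv, ← hA]
    simp [mul_assoc]
  obtain ⟨hval, hγ⟩ := smul_mem_hat_of_normalizes hO hD.split z (fun o ho => by
    have h1 : (y : AdelicQuat a b) * o * (y⁻¹ : (AdelicQuat a b)ˣ) ∈
        hat (Subalgebra.toSubmodule (leftOrder J)) := by
      rw [hat_leftOrder hO.prop hJ.isLattice hJy]
      exact ⟨o, ho, rfl⟩
    have h2 := hle h1
    rw [mem_map_sandwich_inv_iff] at h2
    convert h2 using 1
    rw [hz]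
    simp [mul_assoc])
  have hδ0 : (δ : Quat a b) ≠ 0 := δ.ne_zero
  obtain ⟨γ, hγ0, hγv⟩ := isSqUpToUnits_of_totallyPositive hp hs hF
    (fun σ => hD.totallyDefinite.nr_pos hδ0 σ) (fun v => by
      obtain ⟨c, hc⟩ := hval v
      rw [hnr, evalHom_algebraMap, valued_algebraMap] at hc
      exact ⟨_, hc⟩)
  obtain ⟨hu, hu'⟩ := hγ γ hγ0 (fun v => by
    rw [hnr, evalHom_algebraMap, valued_algebraMap, hγv v])
  -- Both $\gamma^{-1}z$ and its inverse lie in $\widehat{\mathbb O}$, so $\widehat J=\alpha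
  -- xz\widehat{\mathbb O}=\gamma\alpha x\widehat{\mathbb O}=\gamma\alpha\widehat I$.
  refine ⟨⟨γ • (α : Quat a b), γ⁻¹ • ((α⁻¹ : (Quat a b)ˣ) : Quat a b),
    by simp [smul_smul, hγ0], by simp [smul_smul, hγ0]⟩, ?_⟩
  ext w
  constructor
  · intro hw
    refine ⟨γ⁻¹ • (((α⁻¹ : (Quat a b)ˣ) : Quat a b) * w), ?_, by simp [smul_smul, hγ0]⟩
    rw [SetLike.mem_coe, ← globalPart_hat hI.isLattice, mem_globalPart, toQuatOver_smul_field,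
      mem_hat_iff_of_locally_principal hIx, map_mul, ← coe_unitsToAdelic_inv, ← hA]
    have h1 := mul_mem_hat O hu ((mem_hat_iff_of_locally_principal hJy).1 (toQuatOver_mem_hat hw))
    convert h1 using 1
    rw [mul_smul_comm, smul_mul_assoc, hz]
    simp [mul_assoc]
  · rintro ⟨w, hw, rfl⟩
    simp only
    rw [SetLike.mem_coe, ← globalPart_hat hJ.isLattice, mem_globalPart, smul_mul_assoc,
      toQuatOver_smul_field, mem_hat_iff_of_locally_principal hJy, map_mul, ← coe_unitsToAdelic,
      ← hA]
    have h1 := mul_mem_hat O hu' ((mem_hat_iff_of_locally_principal hIx).1 (toQuatOver_mem_hat hw))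
    convert h1 using 1
    rw [mul_smul_comm, smul_mul_assoc, hz]
    simp [mul_assoc]

end

end SpinorType

end

/-! ### The bijection between ideal classes and types. -/

theorem mainTheorem11 (p : ℕ) (hp : p.Prime) {F : Type*} [Field F] [NumberField F]
    (s : F) (hs : s ^ 2 = (p : F)) (hF : IntermediateField.adjoin ℚ {s} = ⊤)
    (a b : F) (hD : SpinorType.IsRamifiedExactlyAtInfinity a b)
    (O : Subalgebra (NumberField.RingOfIntegers F) (SpinorType.Quat a b))
    (hO : SpinorType.IsMaximalOrder O) :
    (∃ Υ : SpinorType.ClSc O → SpinorType.TpSg O,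
      (∀ (I : Submodule (NumberField.RingOfIntegers F) (SpinorType.Quat a b))
        (hI : I ∈ SpinorType.principalSpinorClass O),
        (Υ ⟨SpinorType.idealClass I, Set.mem_image_of_mem _ hI⟩ : Set _) =
          SpinorType.typeOf (SpinorType.leftOrder I)) ∧
      Function.Bijective Υ) ∧
    SpinorType.hSc O = SpinorType.spinorTypeNumber O := by
  have main : ∃ Υ : SpinorType.ClSc O → SpinorType.TpSg O,
      (∀ (I : Submodule (NumberField.RingOfIntegers F) (SpinorType.Quat a b))
        (hI : I ∈ SpinorType.principalSpinorClass O),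
        (Υ ⟨SpinorType.idealClass I, Set.mem_image_of_mem _ hI⟩ : Set _) =
          SpinorType.typeOf (SpinorType.leftOrder I)) ∧
      Function.Bijective Υ := by
    -- $\Upsilon$ is defined on a chosen representative of each class. The next claim is its
    -- independence of that choice.
    choose f hf hfc using fun c : SpinorType.ClSc O => c.2
    have hΥ : ∀ (I : Submodule (NumberField.RingOfIntegers F) (SpinorType.Quat a b))
        (hI : I ∈ SpinorType.principalSpinorClass O),
        SpinorType.typeOf (SpinorType.leftOrder
          (f ⟨SpinorType.idealClass I, Set.mem_image_of_mem _ hI⟩)) =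
          SpinorType.typeOf (SpinorType.leftOrder I) := by
      intro I hI
      refine SpinorType.typeOf_eq_of_mem (SpinorType.leftOrder_mem_typeOf ?_)
      rw [hfc]
      exact SpinorType.mem_idealClass_self I
    refine ⟨fun c => ⟨SpinorType.typeOf (SpinorType.leftOrder (f c)), Set.mem_image_of_mem _
      (SpinorType.leftOrder_mem_spinorGenus hO.prop (hf c))⟩, hΥ, ?_, ?_⟩
    · intro c d hcd
      have hcd' : SpinorType.typeOf (SpinorType.leftOrder (f c)) =
          SpinorType.typeOf (SpinorType.leftOrder (f d)) := congrArg Subtype.val hcd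
      have h1 : SpinorType.leftOrder (f d) ∈ SpinorType.typeOf (SpinorType.leftOrder (f c)) := by
        rw [hcd']
        exact SpinorType.mem_typeOf_self _
      apply Subtype.ext
      rw [← hfc c, ← hfc d]
      exact SpinorType.idealClass_eq_of_mem
        (SpinorType.mem_idealClass_of_leftOrder_mem_typeOf hp hs hF hD hO (hf c) (hf d) h1)
    · rintro ⟨_, O', hO', rfl⟩
      obtain ⟨I, hI, rfl⟩ := SpinorType.exists_leftOrder_eq hO.prop hO'
      exact ⟨⟨_, Set.mem_image_of_mem _ hI⟩, Subtype.ext (hΥ I hI)⟩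
  refine ⟨main, ?_⟩
  obtain ⟨Υ, -, hΥ⟩ := main
  exact Set.encard_congr (Equiv.ofBijective Υ hΥ)
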